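/- Let $k$ be a field of characteristic $0$, $s\in\mathbb N$, and let $k^{\mathbb N}$ denote the space of families $f=(f_w)$ of elements of $k$ indexed by the non-empty words $w$ over $\{1,\dots,s\}$, i.e. of non-commutative power series without constant term. (All constructions below make sense over any commutative ring.) *Free convolution of moments.* For $f,g\in k^{\mathbb N}$, extended by the value $1$ on the empty word, let $f\bullet_{\mathrm F}g$ be the linear functional on $k\langle x_1,\dots,x_s,y_1,\dots,y_s\rangle$ with $(f\bullet_{\mathrm F} g)(1)=1$ and, for a word $V_1\cdots V_m$ decomposed into its maximal non-empty sub-words $V_i$ in only the $x$-letters or only the $y$-letters, $$(f\bullet_{\mathrm F} g)(V_1\cdots V_m)=\sum_{I\subsetneq\{1,\dots,m\}}(-1)^{m-|I|+1}(f\bullet_{\mathrm F} g)\Big(\prod_{i\in I}V_i\Big)\prod_{i\notin I}\varphi_i(V_i),$$ where $\varphi_i=f$ if $V_i$ consists of $x$-letters and $\varphi_i=g$ if it consists of $y$-letters. Put $f\boxplus_V g=(f\bullet_{\mathrm F} g)\circ\Delta_a$, where $\Delta_a$ is the algebra morphism $x_i\mapsto x_i+y_i$. *$\mathcal R$-transform.*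 The boxed convolution is $(f\boxtimes g)_w=\sum_{\pi\in NC(|w|)}\prod_{V\in\pi}f_{w|V}\prod_{V\in K(\pi)}g_{w|V}$, with $K(\pi)$ the Kreweras complement. The series $\mathrm{Moeb}$ is the two-sided $\boxtimes$-inverse of the series $\mathrm{Zeta}$ all of whose coefficients are $1$ (the unit is $x_1+\dots+x_s$). Put $\mathcal R(f)=f\boxtimes\mathrm{Moeb}$; its coefficients are the free cumulants of $f$. Let $d\mathcal R$ be the differential of the polynomial map $\mathcal R$ at $0$. *Logarithm.* For $x\in k^{\mathbb N}$ let $L_x(y)=x\boxplus_V y$, a polynomial map in $y$, with Jacobian matrix $J_{L_x}(0)$ at $y=0$. For $v\in k^{\mathbb N}$ let $\gamma_v$ be the family of polynomials in $t$ with $\gamma_v(0)=0$ and $\gamma_v'(t)=J_{L_{\gamma_v(t)}}(0)\,v$, i.e. the integral curve through $0$ of the left-invariant vector field with coordinates $v$ in the Jacobian basis; put $\mathrm{EXP}_{\boxplus_V}(v)=\gamma_v(1)$ and $\mathrm{LOG}_{\boxplus_V}=\mathrm{EXP}_{\boxplus_V}^{-1}$. The coefficients of $\mathrm{LOG}_{\boxplus_V}(f)$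 are the $\boxplus_V$-cumulants of $f$. **Proposition.** These objects are well defined: $\mathrm{Zeta}\boxtimes\mathrm{Moeb}=\mathrm{Moeb}\boxtimes\mathrm{Zeta}=x_1+\dots+x_s$, for every $v$ there is exactly one curve $\gamma_v$, and $\mathrm{EXP}_{\boxplus_V}$ is bijective. The matrix $(\partial\mathcal R_w/\partial X_u(0))_{w,u}$ of $d\mathcal R$ is lower triangular with unit diagonal, both when words are ordered by length and then lexicographically, and when they are ordered lexicographically. For every $f\in k^{\mathbb N}$ the free cumulants and the $\boxplus_V$-cumulants are related by this linear map: $$\mathcal R(f)=d\mathcal R\big(\mathrm{LOG}_{\boxplus_V}(f)\big),\qquad\text{i.e.}\qquad \mathcal R=d\mathcal R\circ\mathrm{LOG}_{\boxplus_V}.$$ -/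

import Mathlib

open scoped BigOperators

namespace FreeCumulants

universe u

/-! ## Words and series without constant term -/

/-- Non-empty words over the alphabet `[s]`. -/
abbrev Word (s : ℕ) : Type := {w : List (Fin s) // w ≠ []}

/-- Non-commutative power series without constant term in `s` variables, given by their
coefficients.  This is the coordinate space of all the groups below. -/
abbrev Series (s : ℕ) (A : Type u) : Type u := Word s → A

/-- The coefficients of the series with constant term `1` that has the given non-constant
coefficients; equivalently, the values on words of the associated unital linear functional on
`A⟨x_1, …, x_s⟩`. -/
def coeffs {s : ℕ} {A : Type u} [One A] (f : Series s A) (w : List (Fin s)) : A :=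
  if h : w ≠ [] then f ⟨w, h⟩ else 1

/-! ## The free product of functionals and additive free convolution of moments -/

section FreeProduct

variable {s : ℕ} {A : Type u} [CommRing A]

/-- The maximal sub-words `v_1, …, v_l` of a word in the letters `x_i` (`Sum.inl i`) and
`y_i` (`Sum.inr i`) that use only `x`-letters or only `y`-letters; so `u = v_1 ⋯ v_l` is the
alternating product decomposition of `u`. -/
def runs (u : List (Fin s ⊕ Fin s)) : List (List (Fin s ⊕ Fin s)) :=
  u.splitBy (fun a b => a.isLeft == b.isLeft)

/-- The product, in the given order, of the factors `V_i` with `i ∈ I`. -/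
def subword (V : List (List (Fin s ⊕ Fin s))) (I : Finset (Fin V.length)) :
    List (Fin s ⊕ Fin s) :=
  ((List.finRange V.length).filter (fun i => decide (i ∈ I))).flatMap V.get

/-- Forget whether a letter is an `x` or a `y`. -/
def forget (v : List (Fin s ⊕ Fin s)) : List (Fin s) := v.map (Sum.elim id id)

/-- The value on a run: `f` on words in the `x`-letters, `g` on words in the `y`-letters. -/
def runValue (f g : Series s A) (v : List (Fin s ⊕ Fin s)) : A :=
  if v.all Sum.isLeft then coeffs f (forget v) else coeffs g (forget v)

theorem length_filter_flatMap_lt {α β : Type*} (l : List α) (p : α → Bool) (F : α → List β)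
    (a : α) (ha : a ∈ l) (hp : p a = false) (hF : F a ≠ []) :
    ((l.filter p).flatMap F).length < (l.flatMap F).length := by
  have key : ∀ l : List α, ((l.filter p).flatMap F).length ≤ (l.flatMap F).length := by
    intro l
    induction l with
    | nil => simp
    | cons b l ih =>
      by_cases hb : p b = true
      · simp only [List.filter_cons, hb, if_true, List.flatMap_cons, List.length_append]
        omega
      · simp only [List.filter_cons, hb, List.flatMap_cons, List.length_append]
        simp only [Bool.false_eq_true, if_false]
        omega
  induction l with
  | nil => simp at ha
  | cons b l ih =>
    rcases List.mem_cons.1 ha with rfl | ha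
    · have h1 := key l
      have h2 := List.length_pos_iff.2 hF
      simp only [List.filter_cons, hp, Bool.false_eq_true, if_false, List.flatMap_cons,
        List.length_append]
      omega
    · have h1 := ih ha
      by_cases hb : p b = true
      · simp only [List.filter_cons, hb, if_true, List.flatMap_cons, List.length_append]
        omega
      · simp only [List.filter_cons, hb, List.flatMap_cons, List.length_append]
        simp only [Bool.false_eq_true, if_false]
        omega

theorem length_subword_lt (u : List (Fin s ⊕ Fin s)) (I : Finset (Fin (runs u).length))
    (hI : I ∈ (Finset.univ : Finset (Fin (runs u).length)).ssubsets) :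
    (subword (runs u) I).length < u.length := by
  have hI' : I ≠ Finset.univ := (Finset.mem_ssubsets.1 hI).ne
  obtain ⟨i, hi⟩ : ∃ i, i ∉ I := by
    by_contra h
    push Not at h
    exact hI' (Finset.eq_univ_iff_forall.2 h)
  have h1 := length_filter_flatMap_lt (List.finRange (runs u).length)
    (fun i => decide (i ∈ I)) (runs u).get i (List.mem_finRange i) (by simpa using hi)
    (List.ne_nil_of_mem_splitBy (List.get_mem (runs u) i))
  have h2 : ((List.finRange (runs u).length).flatMap (runs u).get).length = u.length := by
    have h3 : (List.finRange (runs u).length).map (runs u).get = runs u := by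
      rw [← List.ofFn_eq_map, List.ofFn_get]
    rw [List.flatMap_def, h3, runs, List.flatten_splitBy]
  rw [h2] at h1
  exact h1

/-- The free product `f •_F g` on words in the `x_i` and `y_i`.  For a word with alternating
product decomposition `V_1 ⋯ V_m`, `m ≥ 1`,
`(f • g)(V_1 ⋯ V_m) = ∑_{I ⊊ {1,…,m}} (-1)^(m-|I|+1) (f • g)(∏_{i ∈ I} V_i) ∏_{i ∉ I} φ_i(V_i)`
with `φ_i = f` or `φ_i = g` according to the letters of `V_i`; the empty word has value `1`. -/
def freeProd (f g : Series s A) (u : List (Fin s ⊕ Fin s)) : A :=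
  if u = [] then 1 else
    ∑ I ∈ (Finset.univ : Finset (Fin (runs u).length)).ssubsets.attach,
      (-1 : A) ^ ((runs u).length - I.1.card + 1) * freeProd f g (subword (runs u) I.1) *
        ∏ i ∈ I.1ᶜ, runValue f g ((runs u).get i)
termination_by u.length
decreasing_by exact length_subword_lt u I.1 I.2

/-- The free product of the functionals `f` and `g` as a linear functional on
`A⟨x_1, …, x_s, y_1, …, y_s⟩ = A⟨x_1, …, x_s⟩ ⨿ A⟨y_1, …, y_s⟩`. -/
noncomputable def freeProdFunctional (f g : Series s A) :
    FreeAlgebra A (Fin s ⊕ Fin s) →ₗ[A] A :=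
  (FreeAlgebra.basisFreeMonoid A (Fin s ⊕ Fin s)).constr A
    (fun u => freeProd f g (FreeMonoid.toList u))

/-- The additive co-product, `Δ_a(x_i) = x_i + y_i`. -/
noncomputable def deltaAdd (s : ℕ) (A : Type u) [CommRing A] :
    FreeAlgebra A (Fin s) →ₐ[A] FreeAlgebra A (Fin s ⊕ Fin s) :=
  FreeAlgebra.lift A
    (fun i => FreeAlgebra.ι A (Sum.inl i) + FreeAlgebra.ι A (Sum.inr i))

/-- The additive free convolution of moment series, `f ⊞_V g = (f •_F g) ∘ Δ_a`. -/
noncomputable def boxplusV (f g : Series s A) : Series s A := fun w =>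
  freeProdFunctional f g (deltaAdd s A (w.1.map (FreeAlgebra.ι A)).prod)

end FreeProduct

/-! ## Non-crossing partitions and the Kreweras complement -/

/-- Partitions of `{1, …, n}`. -/
abbrev Part (n : ℕ) : Type := Finpartition (Finset.univ : Finset (Fin n))

/-- There are no `a < b < c < d` with `a, c` in one block and `b, d` in another one. -/
def IsNC {n : ℕ} (π : Part n) : Prop :=
  ∀ V ∈ π.parts, ∀ W ∈ π.parts, ∀ a ∈ V, ∀ b ∈ W, ∀ c ∈ V, ∀ d ∈ W,
    a < b → b < c → c < d → V = W

/-- `i` and `j` lie in the same block of the Kreweras complement iff every block of `π` is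
contained in, or disjoint from, the interval of the elements `a` with `i < a ≤ j`
(`j < a ≤ i`, if `j < i`). -/
def krewerasSetoid {n : ℕ} (π : Part n) : Setoid (Fin n) where
  r i j := ∀ V ∈ π.parts, ∀ a ∈ V, ∀ b ∈ V, ((a ≤ i ↔ a ≤ j) ↔ (b ≤ i ↔ b ≤ j))
  iseqv :=
    { refl := fun i V _ a _ b _ => by tauto
      symm := fun h V hV a ha b hb => by have := h V hV a ha b hb; tauto
      trans := fun h h' V hV a ha b hb => by
        have h1 := h V hV a ha b hb
        have h2 := h' V hV a ha b hb
        tauto }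

open Classical in
/-- The Kreweras complement `K(π)`. -/
noncomputable def kreweras {n : ℕ} (π : Part n) : Part n :=
  Finpartition.ofSetoid (krewerasSetoid π)

/-- No block of `π`, placed on the points `1, …, n`, crosses a block of `σ`, placed on the
points `1', …, n'`, in the order `1 < 1' < 2 < 2' < ⋯ < n < n'`. -/
def Interlace {n : ℕ} (π σ : Part n) : Prop :=
  ∀ V ∈ π.parts, ∀ W ∈ σ.parts, ∀ a ∈ V, ∀ b ∈ V, ∀ i ∈ W, ∀ j ∈ W,
    ¬ (a ≤ i ∧ i < b ∧ b ≤ j) ∧ ¬ (i < a ∧ a ≤ j ∧ j < b)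

theorem rel_of_mem_kreweras {n : ℕ} (π : Part n) {W : Finset (Fin n)}
    (hW : W ∈ (kreweras π).parts) {i j : Fin n} (hi : i ∈ W) (hj : j ∈ W) :
    krewerasSetoid π i j := by
  classical
  have h1 : (kreweras π).part i = W := (kreweras π).part_eq_of_mem hW hi
  rw [← h1, kreweras, Finpartition.mem_part_ofSetoid_iff_rel] at hj
  exact hj

/-- The standard description of the Kreweras complement: it is the largest non-crossing `σ` such
that no block of `π` crosses a block of `σ` on the points `1 < 1' < 2 < 2' < ⋯ < n < n'`. -/
theorem kreweras_isGreatest {n : ℕ} (π : Part n) :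
    IsGreatest {σ : Part n | IsNC σ ∧ Interlace π σ} (kreweras π) := by
  classical
  have inter : Interlace π (kreweras π) := by
    intro V hV W hW a ha b hb i hi j hj
    have h := rel_of_mem_kreweras π hW hi hj V hV a ha b hb
    simp only [Fin.le_def, Fin.lt_def] at *
    omega
  refine ⟨⟨?_, inter⟩, ?_⟩
  · intro V hV W hW a ha b hb c hc d hd hab hbc hcd
    have hac := rel_of_mem_kreweras π hV ha hc
    have hbd := rel_of_mem_kreweras π hW hb hd
    have hrel : krewerasSetoid π a b := by
      intro U hU p hp q hq
      have h1 := hac U hU p hp q hq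
      have h2 := hbd U hU p hp q hq
      simp only [Fin.le_def, Fin.lt_def] at *
      omega
    have h3 : b ∈ (kreweras π).part a := by
      rw [kreweras, Finpartition.mem_part_ofSetoid_iff_rel]
      exact hrel
    rw [(kreweras π).part_eq_of_mem hV ha] at h3
    exact (kreweras π).eq_of_mem_parts hV hW h3 hb
  · rintro σ ⟨-, hσ⟩ W hW
    obtain ⟨i, hi⟩ := σ.nonempty_of_mem_parts hW
    refine ⟨(kreweras π).part i, (kreweras π).part_mem.2 (Finset.mem_univ i), ?_⟩
    intro j hj
    rw [kreweras, Finpartition.mem_part_ofSetoid_iff_rel]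
    intro V hV a ha b hb
    have h1 := hσ V hV W hW a ha b hb i hi j hj
    have h2 := hσ V hV W hW b hb a ha i hi j hj
    have h3 := hσ V hV W hW a ha b hb j hj i hi
    have h4 := hσ V hV W hW b hb a ha j hj i hi
    simp only [Fin.le_def, Fin.lt_def] at *
    omega

/-! ## Boxed convolution, the Moebius series and the R-transform -/

/-- The restriction `w|V` of a word to a set of positions. -/
def restrict {s : ℕ} (w : List (Fin s)) (V : Finset (Fin w.length)) : List (Fin s) :=
  (V.sort (· ≤ ·)).map w.get

theorem length_restrict {s : ℕ} (w : List (Fin s)) (V : Finset (Fin w.length)) :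
    (restrict w V).length = V.card := by
  simp [restrict]

theorem restrict_ne_nil {s : ℕ} (w : List (Fin s)) (V : Finset (Fin w.length))
    (hV : V.Nonempty) : restrict w V ≠ [] := by
  rw [← List.length_pos_iff, length_restrict]
  exact hV.card_pos

section Boxed

variable {s : ℕ} {A : Type u} [CommRing A]

/-- `X_{w,π}(f)`, the product over the blocks `V` of `π` of the coefficients of `f` at `w|V`. -/
def blockProd (f : Series s A) (w : List (Fin s)) (π : Part w.length) : A :=
  ∏ V ∈ π.parts, coeffs f (restrict w V)

open Classical in
/-- The boxed convolution `f ⊠ g`. -/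
noncomputable def boxed (f g : Series s A) : Series s A := fun w =>
  ∑ π : Part w.1.length with IsNC π, blockProd f w.1 π * blockProd g w.1 (kreweras π)

/-- All coefficients are `1`. -/
def zeta : Series s A := fun _ => 1

/-- The unit `x_1 + ⋯ + x_s` of boxed convolution. -/
def boxedUnit : Series s A := fun w => if w.1.length = 1 then 1 else 0

open Classical in
/-- The Moebius series, the inverse of `zeta` for boxed convolution.  The recursion solves
`Moeb ⊠ zeta = boxedUnit`: the term of the one-block partition in `(Moeb ⊠ zeta)_w` is `Moeb_w`,
and the sum below is over all the other non-crossing partitions. -/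
noncomputable def moeb (w : Word s) : A :=
  boxedUnit w -
    ∑ σ : {σ : Part w.1.length // IsNC σ ∧ Finset.univ ∉ σ.parts},
      ∏ V : {V : Finset (Fin w.1.length) // V ∈ σ.1.parts},
        moeb ⟨restrict w.1 V.1, restrict_ne_nil w.1 V.1 (σ.1.nonempty_of_mem_parts V.2)⟩
termination_by w.1.length
decreasing_by
  rw [length_restrict]
  have h : V.1 ≠ Finset.univ := fun h => σ.2.2 (Eq.subst (motive := fun x => x ∈ σ.1.parts) h V.2)
  have h2 := Finset.card_lt_card (Finset.ssubset_univ_iff.2 h)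
  simpa using h2

/-- The R-transform `f ⊠ Moeb`; its coefficient at `w` is the free cumulant `κ_w(f)`. -/
noncomputable def rTransform (f : Series s A) : Series s A := boxed f moeb

end Boxed

/-! ## Differentials of polynomial maps at the origin -/

section Differential

variable {s : ℕ} {A : Type u} [CommRing A]

/-- The Jacobian matrix at the origin, `∂P_w/∂X_u (0)`, of a polynomial self-map `P` of the
coordinate space. -/
noncomputable def jacobianAtZero (P : Word s → MvPolynomial (Word s) A) :
    Matrix (Word s) (Word s) A :=
  fun w u => MvPolynomial.constantCoeff (MvPolynomial.pderiv u (P w))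

/-- The differential at the origin of a polynomial self-map `P` of the coordinate space:
multiplication by the Jacobian matrix.  Only variables that occur in `P_w` contribute. -/
noncomputable def differentialAtZero (P : Word s → MvPolynomial (Word s) A) :
    Series s A →ₗ[A] Series s A where
  toFun v w := ∑ u ∈ (P w).vars, jacobianAtZero P w u * v u
  map_add' v v' := by
    funext w
    simp [mul_add, Finset.sum_add_distrib]
  map_smul' c v := by
    funext w
    simp [Finset.mul_sum, mul_left_comm]

/-- The left translation `y ↦ x ⊞_V y` as a polynomial map. -/
noncomputable def leftTranslation (x : Series s A) : Word s → MvPolynomial (Word s) A :=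
  boxplusV (fun w => MvPolynomial.C (x w)) MvPolynomial.X

/-- The R-transform as a polynomial map. -/
noncomputable def rTransformPoly (s : ℕ) (A : Type u) [CommRing A] :
    Word s → MvPolynomial (Word s) A :=
  rTransform MvPolynomial.X

end Differential

/-! ## The Lie-theoretic logarithm of the group `(k^ℕ, ⊞_V, 0)` -/

section Log

variable {s : ℕ} {k : Type u} [Field k]

/-- `γ` is the integral curve, starting at the neutral element `0`, of the left-invariant vector
field with coordinates `v` in the Jacobian basis, that is, of `x ↦ J_{L_x}(0) v`. -/
def IsExpCurve (v : Series s k) (γ : Word s → Polynomial k) : Prop :=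
  (∀ w, (γ w).eval 0 = 0) ∧
    ∀ w, Polynomial.derivative (γ w) =
      differentialAtZero (leftTranslation γ) (fun u => Polynomial.C (v u)) w

/-- The exponential map in Jacobian coordinates: the integral curve at time `1`. -/
noncomputable def EXP (v : Series s k) : Series s k :=
  fun w => (Classical.epsilon (IsExpCurve v) w).eval 1

/-- The logarithm in Jacobian coordinates: the inverse of the exponential map.  Its coordinates
are the `⊞_V`-cumulants. -/
noncomputable def LOG : Series s k → Series s k := Function.invFun EXP

end Log

/-- The differential `dR` of the R-transform at the neutral element `0`. -/
noncomputable def dR (s : ℕ) (k : Type u) [Field k] : Series s k →ₗ[k] Series s k :=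
  differentialAtZero (rTransformPoly s k)

/-- A matrix indexed by words is lower triangular with unit diagonal with respect to an ordering
`r` (`r w u`: `w` comes before `u`) of the words. -/
def IsLowerUnitriangular {s : ℕ} {A : Type u} [CommRing A] (r : List (Fin s) → List (Fin s) → Prop)
    (M : Matrix (Word s) (Word s) A) : Prop :=
  (∀ w, M w w = 1) ∧ ∀ w u, r w.1 u.1 → M w u = 0

end FreeCumulants

/-! Free cumulants are coordinates in which everything is linear. Summing products of cumulants over
non-crossing partitions gives `momentSeries`, that is `κ ↦ κ ⊠ zeta`. The Kreweras complement is an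
order-reversing bijection of the non-crossing partitions, and this yields Möbius inversion:
`rTransform` is the two-sided inverse of `momentSeries` (`rTransform_momentSeries`,
`momentSeries_rTransform`).

The recursion for the free product says that alternating products of centred elements have value
zero. Moments whose mixed cumulants vanish satisfy the same recursion (`freeProd_momentSeries`),
because a non-crossing partition with monochromatic blocks always isolates some run. Substituting
`x_i + y_i` then adds cumulants, so `rTransform` carries `⊞_V` to addition (`boxplusV_eq`).

In `R(f)_w` the one-block partition contributes `f_w` and every other partition a product of at
least two coefficients of `f`. Hence `dR` is the identity, triangularity holds for any irreflexive
ordering, and the relation to be shown becomes `LOG = R`. Differentials are computed over dual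
numbers: `R(εv) = εv`, hence `R(x ⊞ εv) = R(x) + εv`. As `p ↦ p + εp'` is a ring homomorphism, the
equation of the exponential curve turns into `R(γ)' = v`. In characteristic `0`, with `γ(0) = 0`,
its only solution is `R(γ) = tv`; at `t = 1` this gives `EXP = momentSeries`. -/

namespace FreeCumulants

universe u v

/-! ## Sums over non-crossing partitions of a finite set of positions -/

section NCSum

variable {ι ι' α : Type*} [LinearOrder ι] [LinearOrder ι'] {A : Type*} [CommRing A]

/-- `P` is the set of blocks of a non-crossing partition of `S`. -/
structure IsNCPartition (S : Finset ι) (P : Finset (Finset ι)) : Prop where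
  nonempty : ∀ V ∈ P, V.Nonempty
  subset : ∀ V ∈ P, V ⊆ S
  cover : ∀ a ∈ S, ∃ V ∈ P, a ∈ V
  eq_of_mem : ∀ V ∈ P, ∀ W ∈ P, ∀ a ∈ V, a ∈ W → V = W
  nc : ∀ V ∈ P, ∀ W ∈ P, ∀ a ∈ V, ∀ b ∈ W, ∀ c ∈ V, ∀ d ∈ W,
    a < b → b < c → c < d → V = W

open Classical in
/-- The non-crossing partitions of `S`. -/
noncomputable def ncPartitions (S : Finset ι) : Finset (Finset (Finset ι)) :=
  S.powerset.powerset.filter (IsNCPartition S)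

theorem mem_ncPartitions {S : Finset ι} {P : Finset (Finset ι)} :
    P ∈ ncPartitions S ↔ IsNCPartition S P := by
  classical
  simp only [ncPartitions, Finset.mem_filter, Finset.mem_powerset, and_iff_right_iff_imp]
  exact fun h V hV => Finset.mem_powerset.2 (h.subset V hV)

/-- The word read off at the positions in `V`. -/
def label (f : ι → α) (V : Finset ι) : List α := (V.sort (· ≤ ·)).map f

theorem label_map (e : ι ↪o ι') (f : ι' → α) (V : Finset ι) :
    label f (V.map e.toEmbedding) = label (f ∘ e) V := by
  have : (V.sort (· ≤ ·)).map e.toEmbedding = (V.map e.toEmbedding).sort (· ≤ ·) :=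
    Finset.map_sort e.toEmbedding V (· ≤ ·) (· ≤ ·) fun a _ b _ => e.le_iff_le.symm
  rw [label, ← this, label, List.map_map]
  rfl

/-- The moment on the positions `S` of a word with letters `f` determined by the cumulants `K`. -/
noncomputable def ncSum (K : List α → A) (f : ι → α) (S : Finset ι) : A :=
  ∑ P ∈ ncPartitions S, ∏ V ∈ P, K (label f V)

theorem IsNCPartition.map {S : Finset ι} {P : Finset (Finset ι)} (h : IsNCPartition S P)
    (e : ι ↪o ι') :
    IsNCPartition (S.map e.toEmbedding) (P.map (Finset.mapEmbedding e.toEmbedding).toEmbedding) := by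
  constructor
  · simpa using h.nonempty
  · simpa using h.subset
  · simpa using h.cover
  · simp only [Finset.mem_map, forall_exists_index, and_imp]
    rintro _ V hV rfl _ W hW rfl a ha ha'
    simp only [RelEmbedding.coe_toEmbedding, Finset.mapEmbedding_apply, Finset.mem_map] at ha ha'
    obtain ⟨a, ha, rfl⟩ := ha
    obtain ⟨b, hb, hab⟩ := ha'
    obtain rfl := e.injective hab
    rw [h.eq_of_mem V hV W hW _ ha hb]
  · simp only [Finset.mem_map, forall_exists_index, and_imp]
    rintro _ V hV rfl _ W hW rfl a ha b hb c hc d hd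
    simp only [RelEmbedding.coe_toEmbedding, Finset.mapEmbedding_apply, Finset.mem_map] at ha hb hc hd
    obtain ⟨a, ha, rfl⟩ := ha
    obtain ⟨b, hb, rfl⟩ := hb
    obtain ⟨c, hc, rfl⟩ := hc
    obtain ⟨d, hd, rfl⟩ := hd
    simp only [e.lt_iff_lt, RelEmbedding.coe_toEmbedding]
    intro h1 h2 h3
    rw [h.nc V hV W hW a ha b hb c hc d hd h1 h2 h3]

theorem IsNCPartition.exists_map {S : Finset ι} (e : ι ↪o ι') {Q : Finset (Finset ι')}
    (h : IsNCPartition (S.map e.toEmbedding) Q) :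
    ∃ P, IsNCPartition S P ∧ P.map (Finset.mapEmbedding e.toEmbedding).toEmbedding = Q := by
  classical
  have hQ : ∃ P : Finset (Finset ι), P.map (Finset.mapEmbedding e.toEmbedding).toEmbedding = Q := by
    refine ⟨S.powerset.filter (fun V => V.map e.toEmbedding ∈ Q), ?_⟩
    ext W
    simp only [Finset.mem_map, Finset.mem_filter, Finset.mem_powerset,
      RelEmbedding.coe_toEmbedding, Finset.mapEmbedding_apply]
    constructor
    · rintro ⟨V, ⟨-, hV⟩, rfl⟩
      exact hV
    · intro hW
      obtain ⟨V, hV, rfl⟩ := Finset.subset_map_iff.1 (h.subset W hW)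
      exact ⟨V, ⟨hV, hW⟩, rfl⟩
  obtain ⟨P, rfl⟩ := hQ
  refine ⟨P, ?_, rfl⟩
  have hm : ∀ V, V ∈ P → V.map e.toEmbedding ∈
      P.map (Finset.mapEmbedding e.toEmbedding).toEmbedding := fun V hV =>
    Finset.mem_map_of_mem (Finset.mapEmbedding e.toEmbedding).toEmbedding hV
  have hi := Finset.map_injective e.toEmbedding
  constructor
  · intro V hV
    simpa using h.nonempty _ (hm V hV)
  · intro V hV
    simpa using h.subset _ (hm V hV)
  · intro a ha
    simpa using h.cover (e a) (by simpa using ha)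
  · intro V hV W hW a ha ha'
    exact hi (h.eq_of_mem _ (hm V hV) _ (hm W hW) (e a) (by simpa using ha) (by simpa using ha'))
  · intro V hV W hW a ha b hb c hc d hd h1 h2 h3
    exact hi (h.nc _ (hm V hV) _ (hm W hW) (e a) (by simpa using ha) (e b) (by simpa using hb)
      (e c) (by simpa using hc) (e d) (by simpa using hd) (by simpa using h1) (by simpa using h2)
      (by simpa using h3))

theorem ncSum_map (K : List α → A) (e : ι ↪o ι') (f : ι' → α) (S : Finset ι) :
    ncSum K f (S.map e.toEmbedding) = ncSum K (f ∘ e) S := by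
  refine (Finset.sum_bij (fun P _ => P.map (Finset.mapEmbedding e.toEmbedding).toEmbedding)
    ?_ ?_ ?_ ?_).symm
  · exact fun P hP => mem_ncPartitions.2 ((mem_ncPartitions.1 hP).map e)
  · exact fun P _ Q _ h => Finset.map_injective _ h
  · intro Q hQ
    obtain ⟨P, hP, rfl⟩ := (mem_ncPartitions.1 hQ).exists_map
    exact ⟨P, mem_ncPartitions.2 hP, rfl⟩
  · intro P _
    rw [Finset.prod_map]
    refine Finset.prod_congr rfl fun V _ => ?_
    rw [← label_map]
    rfl

/-- The increasing enumeration of `S` matches the positions of the subword with `S` itself. Moments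
of all subwords can thus be compared inside one ambient word. -/
theorem ncSum_get_label (K : List α → A) (f : ι → α) (S : Finset ι) :
    ncSum K (label f S).get Finset.univ = ncSum K f S := by
  have h : S.card = (label f S).length := by simp [label]
  have h1 : (label f S).get = f ∘ S.orderEmbOfFin h := by
    funext i
    exact List.getElem_map f
  have h2 := Finset.map_orderEmbOfFin_univ S h
  rw [h1, ← ncSum_map, h2]

theorem ncSum_empty (K : List α → A) (f : ι → α) : ncSum K f ∅ = 1 := by
  have : ncPartitions (∅ : Finset ι) = {∅} := by
    ext P
    rw [mem_ncPartitions, Finset.mem_singleton]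
    constructor
    · intro h
      refine Finset.eq_empty_of_forall_notMem fun V hV => ?_
      obtain ⟨a, ha⟩ := h.nonempty V hV
      exact absurd (h.subset V hV ha) (Finset.notMem_empty a)
    · rintro rfl
      constructor <;> simp
  simp [ncSum, this]

/-- The product of the moments on pairwise non-crossing sets of positions is the sum over the
non-crossing partitions that refine the partition into these sets. -/
theorem prod_ncSum {J : Type*} [Fintype J] (K : List α → A) (f : ι → α) (S : Finset ι)
    (C : J → Finset ι) (hsub : ∀ j, C j ⊆ S) (hcov : ∀ a ∈ S, ∃ j, a ∈ C j)
    (hdisj : ∀ i j a, a ∈ C i → a ∈ C j → i = j)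
    (hnc : ∀ i j, ∀ a ∈ C i, ∀ b ∈ C j, ∀ c ∈ C i, ∀ d ∈ C j, a < b → b < c → c < d → i = j)
    [DecidablePred fun P : Finset (Finset ι) => ∀ V ∈ P, ∃ j, V ⊆ C j] :
    ∏ j, ncSum K f (C j) =
      ∑ P ∈ ncPartitions S with ∀ V ∈ P, ∃ j, V ⊆ C j, ∏ V ∈ P, K (label f V) := by
  classical
  simp only [ncSum]
  rw [Finset.prod_univ_sum]
  have key : ∀ p ∈ Fintype.piFinset (fun j => ncPartitions (C j)), ∀ j, IsNCPartition (C j) (p j) :=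
    fun p hp j => mem_ncPartitions.1 (Fintype.mem_piFinset.1 hp j)
  have huniq : ∀ V : Finset ι, V.Nonempty → ∀ i j, V ⊆ C i → V ⊆ C j → i = j := by
    rintro V ⟨a, ha⟩ i j hi hj
    exact hdisj i j a (hi ha) (hj ha)
  -- A family of partitions of the `C j` corresponds to its union; the inverse sorts the blocks by
  -- the `C j` that contains them, unique by `huniq`. The hypothesis `hnc` keeps the union
  -- non-crossing. Some `C j` may be empty.
  refine Finset.sum_bij' (fun p _ => Finset.univ.biUnion p)
    (fun P _ j => P.filter (· ⊆ C j)) ?_ ?_ ?_ ?_ ?_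
  · intro p hp
    have hp := key p hp
    rw [Finset.mem_filter, mem_ncPartitions]
    simp only [Finset.mem_biUnion, Finset.mem_univ, true_and, forall_exists_index]
    refine ⟨⟨?_, ?_, ?_, ?_, ?_⟩, fun V j hV => ⟨j, (hp j).subset V hV⟩⟩ <;>
      simp only [Finset.mem_biUnion, Finset.mem_univ, true_and, forall_exists_index]
    · exact fun V j hV => (hp j).nonempty V hV
    · exact fun V j hV => ((hp j).subset V hV).trans (hsub j)
    · intro a ha
      obtain ⟨j, hj⟩ := hcov a ha
      obtain ⟨V, hV, haV⟩ := (hp j).cover a hj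
      exact ⟨V, ⟨j, hV⟩, haV⟩
    · intro V i hV W j hW a ha ha'
      obtain rfl := hdisj i j a ((hp i).subset V hV ha) ((hp j).subset W hW ha')
      exact (hp i).eq_of_mem V hV W hW a ha ha'
    · intro V i hV W j hW a ha b hb c hc d hd h1 h2 h3
      have hi := (hp i).subset V hV
      have hj := (hp j).subset W hW
      obtain rfl := hnc i j a (hi ha) b (hj hb) c (hi hc) d (hj hd) h1 h2 h3
      exact (hp i).nc V hV W hW a ha b hb c hc d hd h1 h2 h3
  · intro P hP
    rw [Finset.mem_filter, mem_ncPartitions] at hP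
    obtain ⟨hP, hC⟩ := hP
    refine Fintype.mem_piFinset.2 fun j => mem_ncPartitions.2 ⟨?_, ?_, ?_, ?_, ?_⟩
    · exact fun V hV => hP.nonempty V (Finset.mem_filter.1 hV).1
    · exact fun V hV => (Finset.mem_filter.1 hV).2
    · intro a ha
      obtain ⟨V, hV, haV⟩ := hP.cover a (hsub j ha)
      obtain ⟨i, hi⟩ := hC V hV
      obtain rfl := hdisj i j a (hi haV) ha
      exact ⟨V, Finset.mem_filter.2 ⟨hV, hi⟩, haV⟩
    · exact fun V hV W hW => hP.eq_of_mem V (Finset.mem_filter.1 hV).1 W (Finset.mem_filter.1 hW).1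
    · exact fun V hV W hW => hP.nc V (Finset.mem_filter.1 hV).1 W (Finset.mem_filter.1 hW).1
  · intro p hp
    have hp := key p hp
    funext j
    ext V
    simp only [Finset.mem_filter, Finset.mem_biUnion, Finset.mem_univ, true_and]
    constructor
    · rintro ⟨⟨i, hi⟩, hV⟩
      obtain rfl := huniq V ((hp i).nonempty V hi) i j ((hp i).subset V hi) hV
      exact hi
    · exact fun hV => ⟨⟨j, hV⟩, (hp j).subset V hV⟩
  · intro P hP
    ext V
    simp only [Finset.mem_filter, Finset.mem_biUnion, Finset.mem_univ, true_and]
    constructor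
    · rintro ⟨j, hV, -⟩
      exact hV
    · intro hV
      obtain ⟨j, hj⟩ := (Finset.mem_filter.1 hP).2 V hV
      exact ⟨j, hV, hj⟩
  · intro p hp
    have hp := key p hp
    rw [Finset.prod_biUnion]
    intro i _ j _ hij
    refine Finset.disjoint_left.2 fun V hi hj => hij ?_
    exact huniq V ((hp i).nonempty V hi) i j ((hp i).subset V hi) ((hp j).subset V hj)

end NCSum

/-! ## The Kreweras complement is an anti-isomorphism of the non-crossing partitions -/

section Kreweras

variable {n : ℕ}

theorem IsNC.isNCPartition {π : Part n} (h : IsNC π) : IsNCPartition Finset.univ π.parts where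
  nonempty _ := π.nonempty_of_mem_parts
  subset _ _ := Finset.subset_univ _
  cover a _ := π.exists_mem (Finset.mem_univ a)
  eq_of_mem _ hV _ hW _ ha hb := π.eq_of_mem_parts hV hW ha hb
  nc := h

theorem exists_part_of_isNCPartition {P : Finset (Finset (Fin n))}
    (h : IsNCPartition Finset.univ P) : ∃ π : Part n, IsNC π ∧ π.parts = P := by
  refine ⟨Finpartition.ofExistsUnique P h.subset (fun a ha => ?_) fun h0 => ?_, h.nc, rfl⟩
  · obtain ⟨V, hV, haV⟩ := h.cover a ha
    exact ⟨V, ⟨hV, haV⟩, fun W hW => h.eq_of_mem W hW.1 V hV a hW.2 haV⟩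
  · exact Finset.not_nonempty_empty (h.nonempty _ h0)

open Classical in
theorem sum_ncPartitions {B : Type*} [AddCommMonoid B] (F : Finset (Finset (Fin n)) → B) :
    ∑ P ∈ ncPartitions Finset.univ, F P = ∑ π : Part n with IsNC π, F π.parts := by
  refine (Finset.sum_bij (fun π _ => π.parts) ?_ ?_ ?_ fun _ _ => rfl).symm
  · exact fun π hπ => mem_ncPartitions.2 (Finset.mem_filter.1 hπ).2.isNCPartition
  · exact fun π _ σ _ h => Finpartition.ext h
  · intro P hP
    obtain ⟨π, hπ, rfl⟩ := exists_part_of_isNCPartition (mem_ncPartitions.1 hP)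
    exact ⟨π, by simpa using hπ, rfl⟩

/-- Two positions lie in the same block. -/
def SameBlock (π : Part n) (a b : Fin n) : Prop := ∃ V ∈ π.parts, a ∈ V ∧ b ∈ V

theorem le_iff_sameBlock {π σ : Part n} : π ≤ σ ↔ ∀ a b, SameBlock π a b → SameBlock σ a b := by
  constructor
  · rintro h a b ⟨V, hV, ha, hb⟩
    obtain ⟨W, hW, hVW⟩ := h hV
    exact ⟨W, hW, hVW ha, hVW hb⟩
  · intro h V hV
    obtain ⟨a, ha⟩ := π.nonempty_of_mem_parts hV
    obtain ⟨W, hW, haW⟩ := σ.exists_mem (Finset.mem_univ a)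
    refine ⟨W, hW, fun b hb => ?_⟩
    obtain ⟨W', hW', ha', hb'⟩ := h a b ⟨V, hV, ha, hb⟩
    rwa [σ.eq_of_mem_parts hW hW' haW ha']

/-- The condition is a parity statement about four comparisons, symmetric in the pairs `(a, b)` and
`(i, j)`. So the complement is the polar of `π` for a symmetric relation between pairs of positions
and pairs of gaps. -/
theorem sameBlock_kreweras {π : Part n} {i j : Fin n} :
    SameBlock (kreweras π) i j ↔
      ∀ a b, SameBlock π a b → ((a ≤ i ↔ a ≤ j) ↔ (b ≤ i ↔ b ≤ j)) := by
  classical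
  constructor
  · rintro ⟨W, hW, hi, hj⟩ a b ⟨V, hV, ha, hb⟩
    exact rel_of_mem_kreweras π hW hi hj V hV a ha b hb
  · intro h
    refine ⟨(kreweras π).part i, (kreweras π).part_mem.2 (Finset.mem_univ i),
      (kreweras π).mem_part (Finset.mem_univ i), ?_⟩
    rw [kreweras, Finpartition.mem_part_ofSetoid_iff_rel]
    exact fun V hV a ha b hb => h a b ⟨V, hV, ha, hb⟩

theorem SameBlock.symm {π : Part n} {a b : Fin n} (h : SameBlock π a b) : SameBlock π b a := by
  obtain ⟨V, hV, ha, hb⟩ := h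
  exact ⟨V, hV, hb, ha⟩

theorem SameBlock.trans {π : Part n} {a b c : Fin n} (h : SameBlock π a b)
    (h' : SameBlock π b c) : SameBlock π a c := by
  obtain ⟨V, hV, ha, hb⟩ := h
  obtain ⟨W, hW, hb', hc⟩ := h'
  obtain rfl := π.eq_of_mem_parts hV hW hb hb'
  exact ⟨V, hV, ha, hc⟩

theorem IsNC.sameBlock {π : Part n} (h : IsNC π) {a b c d : Fin n} (hac : SameBlock π a c)
    (hbd : SameBlock π b d) (h1 : a < b) (h2 : b < c) (h3 : c < d) : SameBlock π a b := by
  obtain ⟨V, hV, ha, hc⟩ := hac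
  obtain ⟨W, hW, hb, hd⟩ := hbd
  obtain rfl := h V hV W hW a ha b hb c hc d hd h1 h2 h3
  exact ⟨V, hV, ha, hb⟩

/-- A non-crossing partition is the polar of its Kreweras complement. -/
theorem IsNC.sameBlock_of_kreweras {π : Part n} (h : IsNC π) {a b : Fin n} (hab : a < b)
    (hK : ∀ i j, SameBlock (kreweras π) i j → ((a ≤ i ↔ a ≤ j) ↔ (b ≤ i ↔ b ≤ j))) :
    SameBlock π a b := by
  classical
  by_contra hne
  -- the largest element of the block of `a` below `b`
  obtain ⟨m, hm, hmax⟩ : ∃ m, (SameBlock π a m ∧ m < b) ∧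
      ∀ c, SameBlock π a c → c < b → c ≤ m := by
    have hs : (Finset.univ.filter fun c => SameBlock π a c ∧ c < b).Nonempty :=
      ⟨a, by
        obtain ⟨V, hV, ha⟩ := π.exists_mem (Finset.mem_univ a)
        simpa using ⟨⟨V, hV, ha, ha⟩, hab⟩⟩
    obtain ⟨m, hm, hmax⟩ := Finset.exists_max_image _ id hs
    exact ⟨m, by simpa using hm, fun c hc hcb => hmax c (by simpa using ⟨hc, hcb⟩)⟩
  obtain ⟨ham, hmb⟩ := hm
  have ha_m : a ≤ m := hmax a (ham.trans ham.symm) hab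
  -- If the block of `a` continues beyond `b`, then `b` lies in a gap `(m, m')` of that block, and
  -- by non-crossing no block meets both the gap and its outside. So `m` and `m' - 1` are related in
  -- the complement, yet this pair separates `a` from `b`.
  by_cases hex : ∃ c, SameBlock π a c ∧ b < c
  · obtain ⟨m', ⟨ham', hbm'⟩, hmin⟩ : ∃ m', (SameBlock π a m' ∧ b < m') ∧
        ∀ c, SameBlock π a c → b < c → m' ≤ c := by
      have hs : (Finset.univ.filter fun c => SameBlock π a c ∧ b < c).Nonempty := by
        obtain ⟨c, hc⟩ := hex
        exact ⟨c, by simpa using hc⟩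
      obtain ⟨m', hm', hmin⟩ := Finset.exists_min_image _ id hs
      exact ⟨m', by simpa using hm', fun c hc hcb => hmin c (by simpa using ⟨hc, hcb⟩)⟩
    have hgap : ∀ c, SameBlock π a c → c ≤ m ∨ m' ≤ c := by
      intro c hc
      rcases lt_trichotomy c b with h1 | rfl | h1
      · exact Or.inl (hmax c hc h1)
      · exact absurd hc hne
      · exact Or.inr (hmin c hc h1)
    let j : Fin n := ⟨m'.1 - 1, by omega⟩
    have hjv : (j : ℕ) = m'.1 - 1 := rfl
    have hrel : SameBlock (kreweras π) m j := by
      refine sameBlock_kreweras.2 ?_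
      have main : ∀ p q, SameBlock π p q → m < p → p < m' → m < q ∧ q < m' := by
        intro p q hpq h1 h2
        have hmm' : SameBlock π m m' := ham.symm.trans ham'
        have hp : ¬ SameBlock π a p := by
          intro hp
          rcases hgap p hp with h3 | h3
          · exact absurd h1 (not_lt.2 h3)
          · exact absurd h2 (not_lt.2 h3)
        have hq : ¬ SameBlock π a q := fun hq => hp (hq.trans hpq.symm)
        by_contra hcon
        have h3 : q < m ∨ m' < q := by
          have : q ≠ m := by rintro rfl; exact hq ham
          have : q ≠ m' := by rintro rfl; exact hq ham'
          omega
        rcases h3 with h3 | h3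
        · exact hp (ham.trans ((h.sameBlock hpq.symm hmm' h3 h1 h2).symm.trans hpq.symm))
        · exact hp (ham.trans (h.sameBlock hmm' hpq h1 h2 h3))
      intro p q hpq
      have h1 := main p q hpq
      have h2 := main q p hpq.symm
      simp only [Fin.le_def, Fin.lt_def] at *
      omega
    have := hK m j hrel
    simp only [Fin.le_def, Fin.lt_def] at *
    omega
  · push Not at hex
    have htop : ∀ c, SameBlock π a c → c ≤ m := by
      intro c hc
      rcases lt_trichotomy c b with h1 | rfl | h1
      · exact hmax c hc h1
      · exact absurd hc hne
      · exact absurd h1 (not_lt.2 (hex c hc))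
    obtain ⟨m', ham', hmin⟩ : ∃ m', SameBlock π a m' ∧ ∀ c, SameBlock π a c → m' ≤ c := by
      have hs : (Finset.univ.filter fun c => SameBlock π a c).Nonempty := ⟨m, by simpa using ham⟩
      obtain ⟨m', hm', hmin⟩ := Finset.exists_min_image _ id hs
      exact ⟨m', by simpa using hm', fun c hc => hmin c (by simpa using hc)⟩
    have hm'a : m' ≤ a := hmin a (ham.trans ham.symm)
    -- Now `b` lies after the whole block, which spans `[m', m]`. The gap before `m'` is taken
    -- cyclically: for `m' = 0` it is the last one, `n - 1`.
    let j : Fin n := ⟨if m'.1 = 0 then n - 1 else m'.1 - 1, by split_ifs <;> omega⟩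
    have hjv : (j : ℕ) = if m'.1 = 0 then n - 1 else m'.1 - 1 := rfl
    have hrel : SameBlock (kreweras π) m j := by
      refine sameBlock_kreweras.2 ?_
      have main : ∀ p q, SameBlock π p q → m' ≤ p → p ≤ m → m' ≤ q ∧ q ≤ m := by
        intro p q hpq h1 h2
        by_cases hp : SameBlock π a p
        · exact ⟨hmin q (hp.trans hpq), htop q (hp.trans hpq)⟩
        have hmm' : SameBlock π m' m := ham'.symm.trans ham
        have hpm' : p ≠ m' := by rintro rfl; exact hp ham'
        have hpm : p ≠ m := by rintro rfl; exact hp ham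
        have h1' : m' < p := by omega
        have h2' : p < m := by omega
        by_contra hcon
        have h3 : q < m' ∨ m < q := by omega
        rcases h3 with h3 | h3
        · exact hp (ham'.trans ((h.sameBlock hpq.symm hmm' h3 h1' h2').symm.trans hpq.symm))
        · exact hp (ham'.trans (h.sameBlock hmm' hpq h1' h2' h3))
      intro p q hpq
      have h1 := main p q hpq
      have h2 := main q p hpq.symm
      have hp := p.2
      have hq := q.2
      simp only [Fin.le_def, Fin.lt_def] at *
      split_ifs at hjv <;> omega
    have hb2 := b.2
    have := hK m j hrel
    simp only [Fin.le_def, Fin.lt_def] at *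
    split_ifs at hjv <;> omega

theorem kreweras_isNC (π : Part n) : IsNC (kreweras π) := (kreweras_isGreatest π).1.1

theorem kreweras_anti {π σ : Part n} (h : π ≤ σ) : kreweras σ ≤ kreweras π := by
  rw [le_iff_sameBlock] at h ⊢
  intro i j hij
  rw [sameBlock_kreweras] at hij ⊢
  exact fun a b hab => hij a b (h a b hab)

theorem sameBlock_self (π : Part n) (a : Fin n) : SameBlock π a a := by
  obtain ⟨V, hV, ha⟩ := π.exists_mem (Finset.mem_univ a)
  exact ⟨V, hV, ha, ha⟩

theorem IsNC.le_of_kreweras_le {π σ : Part n} (hσ : IsNC σ) (h : kreweras σ ≤ kreweras π) :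
    π ≤ σ := by
  rw [le_iff_sameBlock] at h ⊢
  have key : ∀ a b, a < b → SameBlock π a b → SameBlock σ a b := fun a b hab hπ =>
    hσ.sameBlock_of_kreweras hab fun i j hij => sameBlock_kreweras.1 (h i j hij) a b hπ
  intro a b hπ
  rcases lt_trichotomy a b with hab | rfl | hab
  · exact key a b hab hπ
  · exact sameBlock_self σ a
  · exact (key b a hab hπ.symm).symm

theorem IsNC.kreweras_le_kreweras {π σ : Part n} (hσ : IsNC σ) :
    kreweras σ ≤ kreweras π ↔ π ≤ σ :=
  ⟨hσ.le_of_kreweras_le, kreweras_anti⟩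

theorem kreweras_injOn : Set.InjOn (kreweras (n := n)) {π | IsNC π} := fun _ hπ _ hσ h =>
  le_antisymm (IsNC.le_of_kreweras_le hσ h.ge) (IsNC.le_of_kreweras_le hπ h.le)

open Classical in
-- An injective self-map of a finite set is bijective, so no inverse of the complement has to be
-- constructed.
theorem sum_kreweras {B : Type*} [AddCommMonoid B] (F : Part n → B) :
    ∑ π : Part n with IsNC π, F (kreweras π) = ∑ π : Part n with IsNC π, F π := by
  have hmaps : ∀ π ∈ Finset.univ.filter (IsNC (n := n)),
      kreweras π ∈ Finset.univ.filter (IsNC (n := n)) := fun π _ => by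
    simpa using kreweras_isNC π
  have hinj : Set.InjOn (kreweras (n := n)) (Finset.univ.filter (IsNC (n := n))) := by
    simpa using kreweras_injOn
  refine Finset.sum_bij (fun π _ => kreweras π) hmaps (fun π hπ σ hσ h => hinj hπ hσ h) ?_
    fun _ _ => rfl
  intro σ hσ
  obtain ⟨π, hπ, h⟩ := Finset.surjOn_of_injOn_of_card_le _ hmaps hinj le_rfl hσ
  exact ⟨π, hπ, h⟩

end Kreweras

/-! ## Moments, free cumulants and Möbius inversion -/

section Moments

variable {s : ℕ} {A : Type u} [CommRing A]

/-- The moment series `κ ⊠ zeta` with free cumulants `κ`. -/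
noncomputable def momentSeries (κ : Series s A) : Series s A := fun w =>
  ncSum (coeffs κ) w.1.get Finset.univ

theorem coeffs_of_ne_nil (f : Series s A) {w : List (Fin s)} (h : w ≠ []) :
    coeffs f w = f ⟨w, h⟩ := dif_pos h

theorem coeffs_momentSeries (κ : Series s A) (w : List (Fin s)) :
    coeffs (momentSeries κ) w = ncSum (coeffs κ) w.get Finset.univ := by
  by_cases h : w = []
  · subst h
    rw [coeffs, dif_neg (by simp)]
    exact (ncSum_empty (coeffs κ) _).symm
  · rw [coeffs_of_ne_nil _ h]
    rfl

theorem coeffs_momentSeries_restrict (κ : Series s A) (w : List (Fin s))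
    (V : Finset (Fin w.length)) :
    coeffs (momentSeries κ) (restrict w V) = ncSum (coeffs κ) w.get V := by
  rw [coeffs_momentSeries]
  exact ncSum_get_label _ _ _

open Classical in
theorem momentSeries_apply (κ : Series s A) (w : Word s) :
    momentSeries κ w = ∑ π : Part w.1.length with IsNC π, blockProd κ w.1 π := by
  rw [momentSeries, ncSum, sum_ncPartitions]
  rfl

open Classical in
-- The blocks of `π` do not cross each other, so `prod_ncSum` applies; the partitions it sums over
-- are exactly the refinements of `π`.
theorem blockProd_momentSeries (κ : Series s A) (w : List (Fin s)) {π : Part w.length}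
    (h : IsNC π) :
    blockProd (momentSeries κ) w π =
      ∑ ρ : Part w.length with IsNC ρ, if ρ ≤ π then blockProd κ w ρ else 0 := by
  have h1 : blockProd (momentSeries κ) w π =
      ∏ j : {V // V ∈ π.parts}, ncSum (coeffs κ) w.get j.1 := by
    rw [blockProd, Finset.prod_subtype π.parts (p := fun V => V ∈ π.parts) (fun _ => Iff.rfl)]
    exact Finset.prod_congr rfl fun V _ => coeffs_momentSeries_restrict κ w V.1
  rw [h1, prod_ncSum _ _ Finset.univ _ (fun _ => Finset.subset_univ _)
    (fun a _ => by
      obtain ⟨V, hV, ha⟩ := π.exists_mem (Finset.mem_univ a)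
      exact ⟨⟨V, hV⟩, ha⟩)
    (fun i j a hi hj => Subtype.ext (π.eq_of_mem_parts i.2 j.2 hi hj))
    (fun i j a ha b hb c hc d hd h1 h2 h3 =>
      Subtype.ext (h i.1 i.2 j.1 j.2 a ha b hb c hc d hd h1 h2 h3)),
    Finset.sum_filter, sum_ncPartitions]
  refine Finset.sum_congr rfl fun ρ _ => ?_
  have : (∀ V ∈ ρ.parts, ∃ j : {V // V ∈ π.parts}, V ⊆ j.1) ↔ ρ ≤ π := by
    constructor
    · intro h V hV
      obtain ⟨j, hj⟩ := h V hV
      exact ⟨j.1, j.2, hj⟩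
    · intro h V hV
      obtain ⟨W, hW, hVW⟩ := h hV
      exact ⟨⟨W, hW⟩, hVW⟩
  simp only [this]
  rfl

/-- The partition of the positions of a word into one block. -/
def oneBlock (w : Word s) : Part w.1.length :=
  Finpartition.indiscrete (Finset.univ_nonempty_iff.2
    ⟨⟨0, List.length_pos_iff.2 w.2⟩⟩).ne_empty

theorem parts_oneBlock (w : Word s) : (oneBlock w).parts = {Finset.univ} := rfl

theorem eq_oneBlock (w : Word s) {π : Part w.1.length} (h : Finset.univ ∈ π.parts) :
    π = oneBlock w := by
  refine Finpartition.ext ?_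
  rw [parts_oneBlock]
  refine Finset.eq_singleton_iff_unique_mem.2 ⟨h, fun V hV => ?_⟩
  obtain ⟨a, ha⟩ := π.nonempty_of_mem_parts hV
  exact π.eq_of_mem_parts hV h ha (Finset.mem_univ a)

theorem isNC_oneBlock (w : Word s) : IsNC (oneBlock w) := by
  intro V hV W hW
  rw [parts_oneBlock, Finset.mem_singleton] at hV hW
  simp [hV, hW]

theorem restrict_univ (w : List (Fin s)) : restrict w Finset.univ = w := by
  rw [restrict, Fin.sort_univ, List.map_get_finRange]

theorem blockProd_oneBlock (f : Series s A) (w : Word s) : blockProd f w.1 (oneBlock w) = f w := by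
  rw [blockProd, parts_oneBlock, Finset.prod_singleton, restrict_univ, coeffs_of_ne_nil _ w.2]

open Classical in
theorem sum_isNC_eq {B : Type*} [AddCommMonoid B] (w : Word s) (F : Part w.1.length → B) :
    ∑ π : Part w.1.length with IsNC π, F π =
      F (oneBlock w) + ∑ π : Part w.1.length with IsNC π ∧ Finset.univ ∉ π.parts, F π := by
  have : Finset.univ.filter (fun π : Part w.1.length => IsNC π) =
      insert (oneBlock w) (Finset.univ.filter fun π => IsNC π ∧ Finset.univ ∉ π.parts) := by
    ext π
    simp only [Finset.mem_filter, Finset.mem_univ, true_and, Finset.mem_insert]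
    constructor
    · intro h
      by_cases h1 : Finset.univ ∈ π.parts
      · exact Or.inl (eq_oneBlock w h1)
      · exact Or.inr ⟨h, h1⟩
    · rintro (rfl | h)
      · exact isNC_oneBlock w
      · exact h.1
  rw [this, Finset.sum_insert]
  simp [parts_oneBlock]

theorem momentSeries_moeb : momentSeries (moeb : Series s A) = boxedUnit := by
  classical
  funext w
  rw [momentSeries_apply, sum_isNC_eq, blockProd_oneBlock, moeb,
    Finset.sum_subtype (p := fun σ : Part w.1.length => IsNC σ ∧ Finset.univ ∉ σ.parts) _
      (fun σ => by simp)]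
  refine (congrArg (fun x => boxedUnit w - x + _) (Finset.sum_congr rfl fun σ _ => ?_)).trans
    (sub_add_cancel _ _)
  rw [blockProd, Finset.prod_subtype σ.1.parts (p := fun V => V ∈ σ.1.parts) (fun _ => Iff.rfl)]
  refine Finset.prod_congr rfl fun V _ => ?_
  rw [coeffs_of_ne_nil _ (restrict_ne_nil w.1 V.1 (σ.1.nonempty_of_mem_parts V.2))]

theorem moeb_of_length_eq_one {w : Word s} (h : w.1.length = 1) : (moeb w : A) = 1 := by
  classical
  have h1 := congrFun (momentSeries_moeb (s := s) (A := A)) w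
  rw [momentSeries_apply, sum_isNC_eq, blockProd_oneBlock, Finset.sum_eq_zero, add_zero] at h1
  · rw [h1, boxedUnit, if_pos h]
  · intro π hπ
    obtain ⟨V, hV, -⟩ := π.exists_mem (Finset.mem_univ ⟨0, List.length_pos_iff.2 w.2⟩)
    obtain ⟨a, ha⟩ := π.nonempty_of_mem_parts hV
    have : V = Finset.univ := by
      refine Finset.eq_univ_of_forall fun b => ?_
      have : a = b := Fin.ext (by omega)
      rwa [← this]
    exact absurd (this ▸ hV) (Finset.mem_filter.1 hπ).2.2

theorem eq_of_sameBlock_kreweras_oneBlock (w : Word s) {i j : Fin w.1.length}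
    (h : SameBlock (kreweras (oneBlock w)) i j) : i = j := by
  rw [sameBlock_kreweras] at h
  -- The polarity condition is tested on the pair `(i, j)` itself, where it reads `i ≤ j ↔ j ≤ i`.
  have h1 := h i j ⟨Finset.univ, by simp [parts_oneBlock]⟩
  simp only [Fin.le_def] at h1
  omega

theorem card_of_sameBlock_imp_eq {n : ℕ} {σ : Part n} (h : ∀ i j, SameBlock σ i j → i = j)
    {V : Finset (Fin n)} (hV : V ∈ σ.parts) : V.card = 1 := by
  obtain ⟨a, ha⟩ := σ.nonempty_of_mem_parts hV
  exact Finset.card_eq_one.2 ⟨a, Finset.eq_singleton_iff_unique_mem.2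
    ⟨ha, fun b hb => h b a ⟨V, hV, hb, ha⟩⟩⟩

theorem blockProd_moeb_kreweras_oneBlock (w : Word s) :
    blockProd (moeb : Series s A) w.1 (kreweras (oneBlock w)) = 1 := by
  refine Finset.prod_eq_one fun V hV => ?_
  rw [coeffs_of_ne_nil _ (restrict_ne_nil w.1 V (Finpartition.nonempty_of_mem_parts _ hV))]
  refine moeb_of_length_eq_one ?_
  rw [length_restrict]
  exact card_of_sameBlock_imp_eq (fun _ _ => eq_of_sameBlock_kreweras_oneBlock w) hV

open Classical in
-- The product is nonzero only if the complement consists of singletons; by injectivity of the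
-- complement only the one-block partition has this property.
theorem blockProd_boxedUnit_kreweras (w : Word s) {π : Part w.1.length} (hπ : IsNC π) :
    blockProd (boxedUnit : Series s A) w.1 (kreweras π) = if π = oneBlock w then 1 else 0 := by
  have hval : ∀ V ∈ (kreweras π).parts, coeffs (boxedUnit : Series s A) (restrict w.1 V) =
      if V.card = 1 then 1 else 0 := by
    intro V hV
    rw [coeffs_of_ne_nil _ (restrict_ne_nil w.1 V (Finpartition.nonempty_of_mem_parts _ hV)),
      boxedUnit, length_restrict]
  rw [blockProd, Finset.prod_congr rfl hval]
  split_ifs with h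
  · subst h
    refine Finset.prod_eq_one fun V hV => if_pos ?_
    exact card_of_sameBlock_imp_eq (fun _ _ => eq_of_sameBlock_kreweras_oneBlock w) hV
  · by_contra hne
    refine h (kreweras_injOn hπ (isNC_oneBlock w) (le_antisymm ?_ ?_))
    · rw [le_iff_sameBlock]
      rintro i j ⟨V, hV, hi, hj⟩
      have hc : V.card = 1 := by
        by_contra hc
        exact hne (Finset.prod_eq_zero hV (if_neg hc))
      rw [Finset.card_le_one.1 hc.le i hi j hj]
      exact sameBlock_self _ _
    · rw [le_iff_sameBlock]
      intro i j hij
      rw [eq_of_sameBlock_kreweras_oneBlock w hij]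
      exact sameBlock_self _ _

open Classical in
-- This is Möbius inversion. Under the complement, the `π` above `ρ` become the `σ` below `kreweras
-- ρ`, so the sum is the block product of `momentSeries moeb = boxedUnit` over `kreweras ρ`.
theorem sum_blockProd_moeb_kreweras (w : Word s) {ρ : Part w.1.length} (hρ : IsNC ρ) :
    (∑ π : Part w.1.length with IsNC π,
      if ρ ≤ π then blockProd (moeb : Series s A) w.1 (kreweras π) else 0) =
      if ρ = oneBlock w then 1 else 0 := by
  rw [← blockProd_boxedUnit_kreweras w hρ, ← momentSeries_moeb,
    blockProd_momentSeries _ _ (kreweras_isNC ρ),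
    ← sum_kreweras (fun σ => if σ ≤ kreweras ρ then blockProd (moeb : Series s A) w.1 σ else 0)]
  refine Finset.sum_congr rfl fun π hπ => ?_
  simp only [IsNC.kreweras_le_kreweras (Finset.mem_filter.1 hπ).2]

theorem rTransform_momentSeries (κ : Series s A) : rTransform (momentSeries κ) = κ := by
  classical
  funext w
  rw [rTransform, boxed, ← blockProd_oneBlock κ w]
  calc ∑ π : Part w.1.length with IsNC π,
        blockProd (momentSeries κ) w.1 π * blockProd moeb w.1 (kreweras π)
      = ∑ π : Part w.1.length with IsNC π, ∑ ρ : Part w.1.length with IsNC ρ,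
          blockProd κ w.1 ρ * if ρ ≤ π then blockProd moeb w.1 (kreweras π) else 0 := by
        refine Finset.sum_congr rfl fun π hπ => ?_
        rw [blockProd_momentSeries _ _ (Finset.mem_filter.1 hπ).2, Finset.sum_mul]
        refine Finset.sum_congr rfl fun ρ _ => ?_
        split_ifs <;> simp
    _ = ∑ ρ : Part w.1.length with IsNC ρ,
          blockProd κ w.1 ρ * if ρ = oneBlock w then 1 else 0 := by
        rw [Finset.sum_comm]
        refine Finset.sum_congr rfl fun ρ hρ => ?_
        rw [← Finset.mul_sum, sum_blockProd_moeb_kreweras w (Finset.mem_filter.1 hρ).2]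
    _ = blockProd κ w.1 (oneBlock w) := by
        rw [Finset.sum_eq_single (oneBlock w)]
        · simp
        · intro ρ _ h
          simp [h]
        · intro h
          exact absurd (by simpa using isNC_oneBlock w) h

/-- The coefficient at `w` is `f w` plus terms in `f` at strictly shorter words, so `f` is recovered
by induction on length. This upgrades the one-sided inverse to a two-sided one. -/
theorem rTransform_injective : Function.Injective (rTransform : Series s A → Series s A) := by
  classical
  intro f g hfg
  have key : ∀ n, ∀ w : Word s, w.1.length = n → f w = g w := by
    intro n
    induction n using Nat.strong_induction_on with
    | _ n ih =>
      intro w hw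
      have h := congrFun hfg w
      simp only [rTransform, boxed] at h
      rw [sum_isNC_eq, sum_isNC_eq, blockProd_oneBlock, blockProd_oneBlock,
        blockProd_moeb_kreweras_oneBlock, mul_one, mul_one] at h
      refine add_right_cancel (h.trans (congrArg _ (Finset.sum_congr rfl fun π hπ => ?_)))
      congr 1
      refine Finset.prod_congr rfl fun V hV => ?_
      have hne := restrict_ne_nil w.1 V (π.nonempty_of_mem_parts hV)
      rw [coeffs_of_ne_nil _ hne, coeffs_of_ne_nil _ hne]
      refine (ih _ ?_ ⟨_, hne⟩ rfl).symm
      have hVu : V ≠ Finset.univ := fun h => (Finset.mem_filter.1 hπ).2.2 (h ▸ hV)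
      have := Finset.card_lt_card (Finset.ssubset_univ_iff.2 hVu)
      simpa [length_restrict, hw] using this
  exact funext fun w => key _ w rfl

theorem momentSeries_rTransform (f : Series s A) : momentSeries (rTransform f) = f :=
  rTransform_injective (rTransform_momentSeries _)

theorem momentSeries_injective : Function.Injective (momentSeries : Series s A → Series s A) :=
  Function.LeftInverse.injective rTransform_momentSeries

theorem blockProd_zeta (w : List (Fin s)) (π : Part w.length) :
    blockProd (zeta : Series s A) w π = 1 := by
  refine Finset.prod_eq_one fun V hV => ?_
  rw [coeffs_of_ne_nil _ (restrict_ne_nil w V (π.nonempty_of_mem_parts hV)), zeta]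

theorem boxed_zeta (κ : Series s A) : boxed κ zeta = momentSeries κ := by
  classical
  funext w
  simp only [boxed, momentSeries_apply, blockProd_zeta, mul_one]

theorem boxed_zeta_moeb : boxed zeta moeb = (boxedUnit : Series s A) := by
  classical
  have h : momentSeries (boxedUnit : Series s A) = zeta := by
    funext w
    rw [momentSeries_apply, ← sum_kreweras,
      Finset.sum_congr rfl fun π hπ =>
        blockProd_boxedUnit_kreweras w (Finset.mem_filter.1 hπ).2,
      Finset.sum_ite_eq' _ (oneBlock w), if_pos (by simpa using isNC_oneBlock w), zeta]
  rw [← h]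
  exact rTransform_momentSeries _

end Moments

/-! ## Vanishing of alternating products of centred elements -/

section Alternating

/-- Some run is a union of blocks, if the colours of consecutive runs differ and the blocks of the
non-crossing partition are monochromatic. -/
theorem IsNCPartition.exists_isolated_run {N m : ℕ} (hm : 0 < m)
    {P : Finset (Finset (Fin N))} (hP : IsNCPartition Finset.univ P) {r : Fin N → Fin m}
    (hr : Monotone r) {c : Fin m → Bool}
    (hc : ∀ i j : Fin m, j.1 = i.1 + 1 → c i ≠ c j)
    (hmono : ∀ V ∈ P, ∀ p ∈ V, ∀ q ∈ V, c (r p) = c (r q)) :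
    ∃ i, ∀ V ∈ P, ∀ p ∈ V, ∀ q ∈ V, r p = i → r q = i := by
  by_contra hcon
  push Not at hcon
  -- If no run is isolated, choose `a < b` in one block and in different runs at minimal distance.
  -- Their runs have the same colour, hence are not consecutive. The run after that of `a` is not
  -- isolated either, and non-crossing traps its offending block between `a` and `b`, giving a
  -- closer pair.
  have hex : ∃ d : ℕ, ∃ V ∈ P, ∃ a ∈ V, ∃ b ∈ V, a < b ∧ r a ≠ r b ∧ b.1 - a.1 = d := by
    obtain ⟨V, hV, p, hp, q, hq, h1, h2⟩ := hcon ⟨0, hm⟩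
    rcases lt_trichotomy p q with h | h | h
    · exact ⟨_, V, hV, p, hp, q, hq, h, fun h' => h2 (h' ▸ h1), rfl⟩
    · exact absurd (h ▸ h1) h2
    · exact ⟨_, V, hV, q, hq, p, hp, h, fun h' => h2 (h'.trans h1), rfl⟩
  classical
  obtain ⟨V, hV, a, ha, b, hb, hab, hrab, hd⟩ := Nat.find_spec hex
  have hmin := fun d (hd : d < Nat.find hex) => Nat.find_min hex hd
  have hlt : r a < r b := lt_of_le_of_ne (hr hab.le) hrab
  have hne : (r b).1 ≠ (r a).1 + 1 := fun h => hc _ _ h (hmono V hV a ha b hb)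
  have hlt' : (r a).1 + 1 < (r b).1 := by
    have : (r a).1 < (r b).1 := hlt
    omega
  have hi : (r a).1 + 1 < m := hlt'.trans (r b).2
  obtain ⟨W, hW, p, hp, q, hq, h1, h2⟩ := hcon ⟨(r a).1 + 1, hi⟩
  have hap : a < p := by
    by_contra h
    have h3 : (r p).1 ≤ (r a).1 := hr (not_lt.1 h)
    rw [h1] at h3
    simp at h3
  have hpb : p < b := by
    by_contra h
    have h3 : (r b).1 ≤ (r p).1 := hr (not_lt.1 h)
    rw [h1] at h3
    exact absurd hlt' (not_lt.2 h3)
  have hVW : V ≠ W := by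
    rintro rfl
    exact hc (r a) (r p) (by rw [h1]) (hmono V hV a ha p hp)
  have haq : a ≤ q := by
    by_contra h
    exact hVW (hP.nc W hW V hV q hq a ha p hp b hb (not_le.1 h) hap hpb).symm
  have hqb : q ≤ b := by
    by_contra h
    exact hVW (hP.nc V hV W hW a ha p hp b hb q hq hap hpb (not_le.1 h))
  have haq' : a ≠ q := fun h => hVW (hP.eq_of_mem V hV W hW a ha (h ▸ hq))
  have hqb' : q ≠ b := fun h => hVW (hP.eq_of_mem V hV W hW b hb (h ▸ hq))
  rcases lt_trichotomy p q with h | h | h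
  · refine hmin (q.1 - p.1) ?_ ⟨W, hW, p, hp, q, hq, h, fun h' => h2 (h' ▸ h1), rfl⟩
    rw [← hd]
    omega
  · exact h2 (h ▸ h1)
  · refine hmin (p.1 - q.1) ?_ ⟨W, hW, q, hq, p, hp, h, fun h' => h2 (h'.trans h1), rfl⟩
    rw [← hd]
    omega

variable {β : Type*} {A : Type*} [CommRing A]

open Classical in
-- Runs are intervals, so the runs outside `I` cross neither each other nor the union of the runs in
-- `I`, and `prod_ncSum` applies. The refinement condition splits into one indicator per run outside
-- `I`, saying that this run is a union of blocks.
theorem ncSum_mul_prod_run {N m : ℕ} (K : List β → A) (f : Fin N → β) {r : Fin N → Fin m}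
    (hr : Monotone r) (I : Finset (Fin m)) :
    ncSum K f (Finset.univ.filter fun p => r p ∈ I) *
        ∏ i ∈ Iᶜ, ncSum K f (Finset.univ.filter fun p => r p = i) =
      ∑ P ∈ ncPartitions (Finset.univ : Finset (Fin N)),
        (∏ i ∈ Iᶜ, if ∀ V ∈ P, ∀ p ∈ V, ∀ q ∈ V, r p = i → r q = i then 1 else 0) *
          ∏ V ∈ P, K (label f V) := by
  -- The index `none` collects all runs in `I`; `some i` is the run `i` for `i ∉ I` and is empty
  -- otherwise, contributing a factor `1`.
  let C : Option (Fin m) → Finset (Fin N) := fun j =>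
    Finset.univ.filter fun p => (if r p ∈ I then none else some (r p)) = j
  have hC : ∀ j p, p ∈ C j ↔ (if r p ∈ I then none else some (r p)) = j := by
    intro j p
    simp [C]
  have hnone : C none = Finset.univ.filter fun p => r p ∈ I := by
    ext p
    rw [hC]
    split_ifs with h <;> simp [h]
  have hsome : ∀ i, C (some i) = if i ∈ I then ∅ else Finset.univ.filter fun p => r p = i := by
    intro i
    ext p
    rw [hC]
    split_ifs with h h' h'
    · simp
    · simp only [Finset.mem_filter, Finset.mem_univ, true_and]
      constructor
      · simp
      · rintro rfl
        exact absurd h h'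
    · simp only [Option.some.injEq, Finset.notMem_empty, iff_false]
      rintro rfl
      exact h h'
    · simp
  have hprod : ∏ j, ncSum K f (C j) = ncSum K f (Finset.univ.filter fun p => r p ∈ I) *
      ∏ i ∈ Iᶜ, ncSum K f (Finset.univ.filter fun p => r p = i) := by
    rw [Fintype.prod_option, hnone]
    congr 1
    rw [← Finset.prod_subset (Finset.subset_univ Iᶜ)]
    · refine Finset.prod_congr rfl fun i hi => ?_
      rw [hsome, if_neg (Finset.mem_compl.1 hi)]
    · intro i _ hi
      rw [hsome, if_pos (by simpa using hi), ncSum_empty]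
  rw [← hprod, prod_ncSum K f Finset.univ C (fun _ => Finset.subset_univ _)
    (fun a _ => ⟨_, (hC _ a).2 rfl⟩)
    (fun i j a hi hj => ((hC i a).1 hi).symm.trans ((hC j a).1 hj)), Finset.sum_filter]
  · refine Finset.sum_congr rfl fun P hP => ?_
    have hiff : (∀ V ∈ P, ∃ j, V ⊆ C j) ↔
        ∀ i ∈ Iᶜ, ∀ V ∈ P, ∀ p ∈ V, ∀ q ∈ V, r p = i → r q = i := by
      constructor
      · intro h i hi V hV p hp q hq hpi
        obtain ⟨j, hj⟩ := h V hV
        have h1 := (hC j p).1 (hj hp)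
        have h2 := (hC j q).1 (hj hq)
        rw [hpi, if_neg (Finset.mem_compl.1 hi)] at h1
        rw [← h1] at h2
        split_ifs at h2
        exact Option.some.inj h2
      · intro h V hV
        by_cases hV' : ∃ p ∈ V, r p ∉ I
        · obtain ⟨p, hp, hpI⟩ := hV'
          refine ⟨some (r p), fun q hq => ?_⟩
          rw [hC, h (r p) (Finset.mem_compl.2 hpI) V hV p hp q hq rfl, if_neg hpI]
        · push Not at hV'
          refine ⟨none, fun q hq => ?_⟩
          rw [hC, if_pos (hV' q hq)]
    by_cases h : ∀ i ∈ Iᶜ, ∀ V ∈ P, ∀ p ∈ V, ∀ q ∈ V, r p = i → r q = i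
    · rw [if_pos (hiff.2 h), Finset.prod_eq_one fun i hi => if_pos (h i hi), one_mul]
    · rw [if_neg fun h' => h (hiff.1 h')]
      obtain ⟨i, hi, hne⟩ : ∃ i ∈ Iᶜ, ¬ ∀ V ∈ P, ∀ p ∈ V, ∀ q ∈ V, r p = i → r q = i := by
        by_contra hcon
        exact h fun i hi => by_contra fun hne => hcon ⟨i, hi, hne⟩
      rw [Finset.prod_eq_zero hi (if_neg hne), zero_mul]
  · intro i j a ha b hb c hc d hd hab hbc hcd
    rw [hC] at ha hb hc hd
    rcases i with _ | i
    · rcases j with _ | j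
      · rfl
      · have h1 : r b = j := by split_ifs at hb; exact Option.some.inj hb
        have h2 : r d = j := by split_ifs at hd; exact Option.some.inj hd
        have h3 : r c = j := le_antisymm (h2 ▸ hr hcd.le) (h1 ▸ hr hbc.le)
        rw [h3, ← h1] at hc
        exact hc.symm.trans hb
    · have h1 : r a = i := by split_ifs at ha; exact Option.some.inj ha
      have h2 : r c = i := by split_ifs at hc; exact Option.some.inj hc
      have h3 : r b = i := le_antisymm (h2 ▸ hr hbc.le) (h1 ▸ hr hab.le)
      rw [h3, ← h1] at hb
      rw [← hb, ← ha]

open Classical in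
-- For a fixed partition the signed sum over `I` factors as a product over the runs of `1` minus the
-- indicator that the run is isolated. Some run is isolated whenever all blocks are monochromatic;
-- otherwise the product of cumulants is already zero.
theorem sum_alternating_eq_zero {N m : ℕ} (hm : 0 < m) (K : List β → A) (f : Fin N → β)
    {r : Fin N → Fin m} (hr : Monotone r) (col : β → Bool) {c : Fin m → Bool}
    (hc : ∀ i j : Fin m, j.1 = i.1 + 1 → c i ≠ c j) (hcol : ∀ p, col (f p) = c (r p))
    (hK : ∀ v, K v ≠ 0 → ∀ x ∈ v, ∀ y ∈ v, col x = col y) :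
    ∑ I : Finset (Fin m), (-1 : A) ^ (m - I.card) *
      (ncSum K f (Finset.univ.filter fun p => r p ∈ I) *
        ∏ i ∈ Iᶜ, ncSum K f (Finset.univ.filter fun p => r p = i)) = 0 := by
  simp only [ncSum_mul_prod_run K f hr, Finset.mul_sum]
  rw [Finset.sum_comm]
  refine Finset.sum_eq_zero fun P hP => ?_
  by_cases h0 : ∏ V ∈ P, K (label f V) = 0
  · simp [h0]
  have hmono : ∀ V ∈ P, ∀ p ∈ V, ∀ q ∈ V, c (r p) = c (r q) := by
    intro V hV p hp q hq
    have hne : K (label f V) ≠ 0 := fun h => h0 (Finset.prod_eq_zero hV h)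
    rw [← hcol, ← hcol]
    refine hK _ hne _ ?_ _ ?_ <;> refine List.mem_map_of_mem ?_ <;> simpa
  obtain ⟨i, hi⟩ := (mem_ncPartitions.1 hP).exists_isolated_run hm hr hc hmono
  have hterm : ∀ I : Finset (Fin m), (-1 : A) ^ (m - I.card) *
      ((∏ i ∈ Iᶜ, if ∀ V ∈ P, ∀ p ∈ V, ∀ q ∈ V, r p = i → r q = i then 1 else 0) *
        ∏ V ∈ P, K (label f V)) =
      ((∏ i ∈ I, 1) * ∏ i ∈ Finset.univ \ I,
        -(if ∀ V ∈ P, ∀ p ∈ V, ∀ q ∈ V, r p = i → r q = i then 1 else 0)) *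
        ∏ V ∈ P, K (label f V) := by
    intro I
    rw [Finset.prod_const_one, one_mul, Finset.prod_neg, ← Finset.compl_eq_univ_sdiff,
      Finset.card_compl, Fintype.card_fin, mul_assoc]
  rw [Finset.sum_congr rfl fun I _ => hterm I, ← Finset.sum_mul, ← Finset.powerset_univ,
    ← Finset.prod_add, Finset.prod_eq_zero (Finset.mem_univ i), zero_mul]
  rw [if_pos hi, add_neg_cancel]

theorem label_filter_get {γ : Type*} (U : List γ) (g : γ → β) (q : γ → Prop) [DecidablePred q] :
    label (fun p => g (U.get p)) (Finset.univ.filter fun p => q (U.get p)) =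
      (U.filter fun x => decide (q x)).map g := by
  have h : (Finset.univ.filter fun p => q (U.get p)).sort (· ≤ ·) =
      (List.finRange U.length).filter fun p => decide (q (U.get p)) := by
    have hs : ((List.finRange U.length).filter fun p => decide (q (U.get p))).Pairwise (· ≤ ·) :=
      (List.pairwise_le_finRange _).filter _
    rw [← (List.toFinset_sort (· ≤ ·) ((List.nodup_finRange _).filter _)).2 hs]
    congr 1
    ext p
    simp
  rw [label, h]
  conv_rhs => rw [← List.map_get_finRange U]
  rw [List.filter_map, List.map_map]
  rfl

end Alternating

/-! ## The free product in terms of free cumulants -/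

section FreeMoments

theorem ncSum_get_map {α β A : Type*} [CommRing A] (K : List β → A) (g : α → β) (v : List α) :
    ncSum K (v.map g).get Finset.univ = ncSum (fun l => K (l.map g)) v.get Finset.univ := by
  have hl : ∀ V : Finset (Fin v.length), label (g ∘ v.get) V = (label v.get V).map g := fun V => by
    rw [label, label, List.map_map]
  have hu : label (g ∘ v.get) Finset.univ = v.map g := by
    rw [hl, label, Fin.sort_univ, List.map_get_finRange]
  rw [← hu, ncSum_get_label]
  exact Finset.sum_congr rfl fun P _ => Finset.prod_congr rfl fun V _ => by rw [hl]

theorem ncSum_congr {α ι A : Type*} [LinearOrder ι] [CommRing A] {K K' : List α → A} (f : ι → α)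
    (S : Finset ι) (h : ∀ V : Finset ι, V.Nonempty → K (label f V) = K' (label f V)) :
    ncSum K f S = ncSum K' f S :=
  Finset.sum_congr rfl fun _ hP => Finset.prod_congr rfl fun V hV =>
    h V ((mem_ncPartitions.1 hP).nonempty V hV)

variable {s : ℕ} {A : Type u} [CommRing A]

/-- The free cumulants of two free families: those with mixed entries vanish. -/
def mixedCumulant (κ μ : Series s A) (v : List (Fin s ⊕ Fin s)) : A :=
  if v.all Sum.isLeft then coeffs κ (forget v)
  else if v.all Sum.isRight then coeffs μ (forget v) else 0

/-- The moments with the free cumulants `mixedCumulant κ μ`. -/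
noncomputable def freeMoment (κ μ : Series s A) (u : List (Fin s ⊕ Fin s)) : A :=
  ncSum (mixedCumulant κ μ) u.get Finset.univ

theorem mem_of_mem_label {α ι : Type*} [LinearOrder ι] {f : ι → α} {V : Finset ι} {x : α}
    (h : x ∈ label f V) : ∃ i ∈ V, f i = x := by
  simpa [label] using h

theorem label_ne_nil {α ι : Type*} [LinearOrder ι] {f : ι → α} {V : Finset ι} (h : V.Nonempty) :
    label f V ≠ [] := by
  rw [← List.length_pos_iff]
  simpa [label] using h

theorem freeMoment_eq_runValue (κ μ : Series s A) (v : List (Fin s ⊕ Fin s)) {c : Bool}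
    (hc : ∀ x ∈ v, x.isLeft = c) (hv : v ≠ []) :
    freeMoment κ μ v = runValue (momentSeries κ) (momentSeries μ) v := by
  have hmem : ∀ V : Finset (Fin v.length), ∀ x ∈ label v.get V, x.isLeft = c := by
    intro V x hx
    obtain ⟨i, -, rfl⟩ := mem_of_mem_label hx
    exact hc _ (List.get_mem _ _)
  rw [runValue]
  cases c
  -- The empty word passes the test `all Sum.isLeft`, so nonemptiness is needed to reach the second
  -- branch.
  · have hall : ∀ l : List (Fin s ⊕ Fin s), l ≠ [] → (∀ x ∈ l, x.isLeft = false) →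
        ¬ (l.all Sum.isLeft = true) := by
      intro l hl h h'
      obtain ⟨x, hx⟩ := List.exists_mem_of_ne_nil l hl
      have := h x hx
      rw [List.all_eq_true.1 h' x hx] at this
      exact absurd this (by decide)
    rw [if_neg (hall v hv hc), coeffs_momentSeries, forget, ncSum_get_map]
    refine ncSum_congr _ _ fun V hV => ?_
    rw [mixedCumulant, if_neg (hall _ (label_ne_nil hV) (hmem V)), if_pos, forget]
    exact List.all_eq_true.2 fun x hx => by simpa using hmem V x hx
  · rw [if_pos (List.all_eq_true.2 hc), coeffs_momentSeries, forget, ncSum_get_map]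
    refine ncSum_congr _ _ fun V hV => ?_
    rw [mixedCumulant, if_pos (List.all_eq_true.2 (hmem V)), forget]

theorem mixedCumulant_ne_zero {κ μ : Series s A} {v : List (Fin s ⊕ Fin s)}
    (h : mixedCumulant κ μ v ≠ 0) : ∀ x ∈ v, ∀ y ∈ v, x.isLeft = y.isLeft := by
  rw [mixedCumulant] at h
  split_ifs at h with h1 h2
  · intro x hx y hy
    rw [List.all_eq_true.1 h1 x hx, List.all_eq_true.1 h1 y hy]
  · intro x hx y hy
    have hx' := List.all_eq_true.1 h2 x hx
    have hy' := List.all_eq_true.1 h2 y hy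
    rw [← Sum.not_isLeft, Bool.not_eq_true] at hx' hy'
    rw [hx', hy']
  · exact absurd rfl h

open Classical in
theorem sum_freeMoment_eq_zero (κ μ : Series s A) {L : List (List (Fin s ⊕ Fin s))} (hL : L ≠ [])
    {c : Fin L.length → Bool} (hc : ∀ i j : Fin L.length, j.1 = i.1 + 1 → c i ≠ c j)
    (hcol : ∀ i, ∀ x ∈ L.get i, x.isLeft = c i) :
    ∑ I : Finset (Fin L.length), (-1 : A) ^ (L.length - I.card) *
      (freeMoment κ μ (subword L I) * ∏ i ∈ Iᶜ, freeMoment κ μ (L.get i)) = 0 := by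
  -- Each letter is tagged with the index of its run, so that all the words `subword L I` arise by
  -- filtering one word.
  let U : List (Fin L.length × (Fin s ⊕ Fin s)) :=
    (List.finRange L.length).flatMap fun i => (L.get i).map (Prod.mk i)
  have hU : ∀ p : Fin U.length, (U.get p).2 ∈ L.get (U.get p).1 := by
    intro p
    obtain ⟨i, -, hi⟩ := List.mem_flatMap.1 (List.get_mem U p)
    obtain ⟨x, hx, h⟩ := List.mem_map.1 hi
    rw [← h]
    exact hx
  have hmono : Monotone fun p : Fin U.length => (U.get p).1 := by
    have hpair : U.Pairwise fun a b => a.1 ≤ b.1 := by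
      rw [List.pairwise_flatMap]
      constructor
      · intro i _
        rw [List.pairwise_map]
        exact List.pairwise_of_forall fun _ _ => le_rfl
      · refine (List.pairwise_le_finRange _).imp fun {i j} hij x hx y hy => ?_
        obtain ⟨_, -, rfl⟩ := List.mem_map.1 hx
        obtain ⟨_, -, rfl⟩ := List.mem_map.1 hy
        exact hij
    intro p q hpq
    rcases hpq.lt_or_eq with h | rfl
    · exact List.pairwise_iff_get.1 hpair p q h
    · exact le_rfl
  have hfilter : ∀ I : Finset (Fin L.length),
      (U.filter fun x => decide (x.1 ∈ I)).map Prod.snd = subword L I := by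
    intro I
    rw [subword, List.filter_flatMap, List.map_flatMap]
    generalize List.finRange L.length = l
    induction l with
    | nil => rfl
    | cons i l ih =>
      rw [List.flatMap_cons, ih, List.filter_cons]
      by_cases hi : i ∈ I
      · simp [hi, List.filter_map, Function.comp_def]
      · simp [hi, List.filter_map, Function.comp_def]
  have hsub : ∀ I : Finset (Fin L.length), ncSum (mixedCumulant κ μ) (fun p => (U.get p).2)
      (Finset.univ.filter fun p => (U.get p).1 ∈ I) = freeMoment κ μ (subword L I) := by
    intro I
    rw [← ncSum_get_label, label_filter_get U Prod.snd (fun x => x.1 ∈ I), hfilter]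
    rfl
  have hrun : ∀ i : Fin L.length, ncSum (mixedCumulant κ μ) (fun p => (U.get p).2)
      (Finset.univ.filter fun p => (U.get p).1 = i) = freeMoment κ μ (L.get i) := by
    intro i
    have h1 : subword L {i} = L.get i := by
      have : (List.finRange L.length).filter (fun j => decide (j ∈ ({i} : Finset _))) = [i] := by
        exact List.perm_singleton.1 ((List.perm_ext_iff_of_nodup
          ((List.nodup_finRange _).filter _) (List.nodup_singleton _)).2 fun j => by simp)
      rw [subword, this]
      simp
    rw [← h1, ← hsub]
    simp
  have := sum_alternating_eq_zero (List.length_pos_iff.2 hL) (mixedCumulant κ μ)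
    (fun p : Fin U.length => (U.get p).2) hmono Sum.isLeft hc (fun p => hcol _ _ (hU p))
    (fun v hv => mixedCumulant_ne_zero hv)
  simpa only [hsub, hrun] using this

theorem exists_colour_runs (u : List (Fin s ⊕ Fin s)) : ∃ c : Fin (runs u).length → Bool,
    (∀ i j : Fin (runs u).length, j.1 = i.1 + 1 → c i ≠ c j) ∧
      ∀ i, ∀ x ∈ (runs u).get i, x.isLeft = c i := by
  have hmono : ∀ v ∈ runs u, ∀ x ∈ v, ∀ y ∈ v, x.isLeft = y.isLeft := by
    intro v hv x hx y hy
    have h1 := List.isChain_of_mem_splitBy hv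
    have h2 : v.IsChain fun a b => a.isLeft = b.isLeft := h1.imp fun a b h => by simpa using h
    have : IsTrans (Fin s ⊕ Fin s) fun a b => a.isLeft = b.isLeft := ⟨fun _ _ _ => Eq.trans⟩
    have : Std.Symm fun a b : Fin s ⊕ Fin s => a.isLeft = b.isLeft := ⟨fun _ _ => Eq.symm⟩
    exact List.Pairwise.forall_of_forall (R := fun a b : Fin s ⊕ Fin s => a.isLeft = b.isLeft)
      (fun _ _ => rfl) (List.isChain_iff_pairwise.1 h2) hx hy
  have hne : ∀ i, (runs u).get i ≠ [] := fun i =>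
    List.ne_nil_of_mem_splitBy (List.get_mem (runs u) i)
  refine ⟨fun i => ((runs u).get i).head (hne i) |>.isLeft, ?_, fun i x hx =>
    hmono _ (List.get_mem _ _) x hx _ (List.head_mem _)⟩
  rintro i ⟨j, hj⟩ rfl h
  have h1 := List.isChain_getLast_head_splitBy (fun a b : Fin s ⊕ Fin s => a.isLeft == b.isLeft) u
  obtain ⟨ha, hb, h2⟩ := List.isChain_iff_getElem.1 h1 i.1 hj
  rw [beq_eq_false_iff_ne] at h2
  exact h2 ((hmono _ (List.get_mem _ i) _ (List.getLast_mem _) _ (List.head_mem _)).trans h)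

theorem subword_univ (u : List (Fin s ⊕ Fin s)) : subword (runs u) Finset.univ = u := by
  have h : (List.finRange (runs u).length).map (runs u).get = runs u := List.map_get_finRange _
  simp only [subword, Finset.mem_univ, decide_true, List.filter_true]
  rw [List.flatMap_def, h, runs, List.flatten_splitBy]

/-- Solving the vanishing alternating sum for its term `I = univ` gives the recursion that defines
`freeProd`; induction on length identifies the two sides. -/
theorem freeProd_momentSeries (κ μ : Series s A) (u : List (Fin s ⊕ Fin s)) :
    freeProd (momentSeries κ) (momentSeries μ) u = freeMoment κ μ u := by
  classical
  induction hn : u.length using Nat.strong_induction_on generalizing u with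
  | _ n ih =>
    rw [freeProd]
    split_ifs with hu
    · subst hu
      exact (ncSum_empty _ _).symm
    · obtain ⟨c, hc, hcol⟩ := exists_colour_runs u
      have hL : runs u ≠ [] := List.splitBy_ne_nil.2 hu
      have hrun : ∀ i, runValue (momentSeries κ) (momentSeries μ) ((runs u).get i) =
          freeMoment κ μ ((runs u).get i) := fun i =>
        (freeMoment_eq_runValue κ μ _ (hcol i)
          (List.ne_nil_of_mem_splitBy (List.get_mem (runs u) i))).symm
      have hsum := sum_freeMoment_eq_zero κ μ hL hc hcol
      rw [← Finset.powerset_univ, ← Finset.add_sum_erase _ _ (Finset.mem_powerset_self _),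
        Finset.card_univ, Fintype.card_fin, Nat.sub_self, pow_zero, one_mul,
        Finset.compl_univ, Finset.prod_empty, mul_one, subword_univ] at hsum
      rw [eq_neg_of_add_eq_zero_left hsum, ← Finset.sum_neg_distrib]
      have hss : (Finset.univ : Finset (Fin (runs u).length)).powerset.erase Finset.univ =
          Finset.univ.ssubsets := by
        ext I
        simp only [Finset.ssubsets, Finset.mem_erase]
      rw [hss]
      refine Eq.trans (Finset.sum_congr rfl fun I _ => ?_) (Finset.sum_attach _ _)
      rw [ih _ (hn ▸ length_subword_lt u I.1 I.2) _ rfl, pow_succ, Finset.prod_congr rfl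
        fun i _ => hrun i]
      ring

end FreeMoments

/-! ## Additive free convolution linearises in free cumulants -/

section Convolution

variable {s : ℕ} {A : Type u} [CommRing A]

/-- The letter `x_i` or `y_i`. -/
def colouredLetter (b : Bool) (i : Fin s) : Fin s ⊕ Fin s := bif b then Sum.inl i else Sum.inr i

theorem isLeft_colouredLetter (b : Bool) (i : Fin s) : (colouredLetter b i).isLeft = b := by
  cases b <;> rfl

theorem elim_colouredLetter (b : Bool) (i : Fin s) :
    Sum.elim id id (colouredLetter b i) = i := by
  cases b <;> rfl

theorem deltaAdd_word (w : List (Fin s)) :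
    deltaAdd s A (w.map (FreeAlgebra.ι A)).prod =
      ∑ c : Fin w.length → Bool,
        ((List.ofFn fun p => colouredLetter (c p) (w.get p)).map (FreeAlgebra.ι A)).prod := by
  have h1 : deltaAdd s A (w.map (FreeAlgebra.ι A)).prod =
      (List.ofFn fun p => ∑ b : Bool, FreeAlgebra.ι A (colouredLetter b (w.get p))).prod := by
    rw [map_list_prod, List.map_map]
    conv_lhs => rw [← List.ofFn_get w, List.map_ofFn]
    congr 2
    funext p
    simp [deltaAdd, colouredLetter]
  rw [h1, ← MultilinearMap.mkPiAlgebraFin_apply (R := A), MultilinearMap.map_sum]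
  refine Finset.sum_congr rfl fun c _ => ?_
  rw [MultilinearMap.mkPiAlgebraFin_apply, List.map_ofFn]
  rfl

theorem freeProdFunctional_word (f g : Series s A) (u : List (Fin s ⊕ Fin s)) :
    freeProdFunctional f g (u.map (FreeAlgebra.ι A)).prod = freeProd f g u := by
  have : (u.map (FreeAlgebra.ι A)).prod =
      FreeAlgebra.basisFreeMonoid A (Fin s ⊕ Fin s) (FreeMonoid.ofList u) := by
    have h : FreeAlgebra.basisFreeMonoid A (Fin s ⊕ Fin s) (FreeMonoid.ofList u) =
        FreeAlgebra.equivMonoidAlgebraFreeMonoid.symm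
          (MonoidAlgebra.of A (FreeMonoid (Fin s ⊕ Fin s)) (FreeMonoid.ofList u)) := rfl
    rw [h]
    change _ = MonoidAlgebra.lift A _ _ (FreeMonoid.lift (FreeAlgebra.ι A)) _
    rw [MonoidAlgebra.lift_of, FreeMonoid.lift_ofList]
  rw [this, freeProdFunctional, Module.Basis.constr_basis]
  rfl

theorem boxplusV_apply (f g : Series s A) (w : Word s) :
    boxplusV f g w = ∑ c : Fin w.1.length → Bool,
      freeProd f g (List.ofFn fun p => colouredLetter (c p) (w.1.get p)) := by
  rw [boxplusV, deltaAdd_word, map_sum]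
  exact Finset.sum_congr rfl fun c _ => freeProdFunctional_word f g _

theorem label_univ {n : ℕ} {α : Type*} (f : Fin n → α) : label f Finset.univ = List.ofFn f := by
  rw [label, Fin.sort_univ, List.ofFn_eq_map]

theorem freeMoment_ofFn (κ μ : Series s A) {n : ℕ} (f : Fin n → Fin s ⊕ Fin s) :
    freeMoment κ μ (List.ofFn f) = ncSum (mixedCumulant κ μ) f Finset.univ := by
  rw [← label_univ, freeMoment, ncSum_get_label]

theorem mixedCumulant_coloured (κ μ : Series s A) {n : ℕ} (f : Fin n → Fin s) (c : Fin n → Bool)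
    {V : Finset (Fin n)} {b : Bool} (hb : ∀ p ∈ V, c p = b) (hV : V.Nonempty) :
    mixedCumulant κ μ (label (fun p => colouredLetter (c p) (f p)) V) =
      bif b then coeffs κ (label f V) else coeffs μ (label f V) := by
  have hforget : forget (label (fun p => colouredLetter (c p) (f p)) V) = label f V := by
    rw [forget, label, List.map_map, label]
    exact List.map_congr_left fun p _ => elim_colouredLetter _ _
  have hmem : ∀ x ∈ label (fun p => colouredLetter (c p) (f p)) V, x.isLeft = b := by
    intro x hx
    obtain ⟨p, hp, rfl⟩ := mem_of_mem_label hx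
    rw [isLeft_colouredLetter, hb p hp]
  rw [mixedCumulant, hforget]
  cases b
  · rw [if_neg, if_pos]
    · rfl
    · exact List.all_eq_true.2 fun x hx => by simpa using hmem x hx
    · intro h
      obtain ⟨p, hp⟩ := hV
      have hx : colouredLetter (c p) (f p) ∈ label (fun p => colouredLetter (c p) (f p)) V :=
        List.mem_map_of_mem (by simpa using hp)
      exact absurd (hmem _ hx) (by rw [List.all_eq_true.1 h _ hx]; decide)
  · rw [if_pos (List.all_eq_true.2 hmem)]
    rfl

theorem coeffs_add (κ μ : Series s A) {w : List (Fin s)} (h : w ≠ []) :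
    coeffs (κ + μ) w = coeffs κ w + coeffs μ w := by
  simp [coeffs_of_ne_nil _ h]

/-- Only colourings constant on every block contribute. They correspond to the subsets `T` of blocks
coloured `x`, which also index the expansion of the product of the sums `κ + μ`. -/
theorem sum_prod_mixedCumulant (κ μ : Series s A) {n : ℕ} (f : Fin n → Fin s)
    {P : Finset (Finset (Fin n))} (hP : IsNCPartition Finset.univ P) :
    ∑ c : Fin n → Bool,
        ∏ V ∈ P, mixedCumulant κ μ (label (fun p => colouredLetter (c p) (f p)) V) =
      ∏ V ∈ P, coeffs (κ + μ) (label f V) := by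
  classical
  rw [Finset.prod_congr rfl fun V hV => coeffs_add κ μ (label_ne_nil (hP.nonempty V hV)),
    Finset.prod_add]
  have hT : ∀ T ∈ P.powerset, ∀ V ∈ P, ∀ p ∈ V, (∃ W ∈ T, p ∈ W) ↔ V ∈ T := by
    intro T hT V hV p hp
    constructor
    · rintro ⟨W, hW, hpW⟩
      rwa [hP.eq_of_mem V hV W (Finset.mem_powerset.1 hT hW) p hp hpW]
    · exact fun h => ⟨V, h, hp⟩
  refine (Finset.sum_of_injOn (fun T p => decide (∃ W ∈ T, p ∈ W)) ?_
    (fun _ _ => Finset.mem_coe.2 (Finset.mem_univ _)) ?_ ?_).symm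
  · intro T₁ h₁ T₂ h₂ h
    have key : ∀ V ∈ P, V ∈ T₁ ↔ V ∈ T₂ := by
      intro V hV
      obtain ⟨p, hp⟩ := hP.nonempty V hV
      rw [← hT T₁ h₁ V hV p hp, ← hT T₂ h₂ V hV p hp]
      exact decide_eq_decide.1 (congrFun h p)
    ext V
    constructor
    · exact fun hV => (key V (Finset.mem_powerset.1 h₁ hV)).1 hV
    · exact fun hV => (key V (Finset.mem_powerset.1 h₂ hV)).2 hV
  · intro c _ hc
    by_contra hne
    have hconst : ∀ V ∈ P, ∀ p ∈ V, ∀ q ∈ V, c p = c q := by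
      intro V hV p hp q hq
      have h0 : mixedCumulant κ μ (label (fun p => colouredLetter (c p) (f p)) V) ≠ 0 :=
        fun h => hne (Finset.prod_eq_zero hV h)
      have := mixedCumulant_ne_zero h0 (colouredLetter (c p) (f p))
        (List.mem_map_of_mem (by simpa using hp)) (colouredLetter (c q) (f q))
        (List.mem_map_of_mem (by simpa using hq))
      rwa [isLeft_colouredLetter, isLeft_colouredLetter] at this
    refine hc ⟨P.filter fun V => ∀ p ∈ V, c p = true,
      Finset.mem_coe.2 (Finset.mem_powerset.2 (Finset.filter_subset _ _)), ?_⟩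
    funext p
    obtain ⟨V, hV, hp⟩ := hP.cover p (Finset.mem_univ p)
    rw [Bool.eq_iff_iff, decide_eq_true_iff]
    constructor
    · rintro ⟨W, hW, hpW⟩
      exact (Finset.mem_filter.1 hW).2 p hpW
    · exact fun h => ⟨V, Finset.mem_filter.2 ⟨hV, fun q hq => hconst V hV q hq p hp ▸ h⟩, hp⟩
  · intro T hTP
    rw [← Finset.prod_sdiff (Finset.mem_powerset.1 hTP), mul_comm]
    congr 1
    · refine Finset.prod_congr rfl fun V hV => ?_
      obtain ⟨hVP, hVT⟩ := Finset.mem_sdiff.1 hV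
      rw [mixedCumulant_coloured κ μ f _ (b := false) (fun p hp => ?_) (hP.nonempty V hVP)]
      · rfl
      · rw [decide_eq_false_iff_not, hT T hTP V hVP p hp]
        exact hVT
    · refine Finset.prod_congr rfl fun V hV => ?_
      have hVP := Finset.mem_powerset.1 hTP hV
      rw [mixedCumulant_coloured κ μ f _ (b := true) (fun p hp => ?_) (hP.nonempty V hVP)]
      · rfl
      · rw [decide_eq_true_iff, hT T hTP V hVP p hp]
        exact hV

theorem boxplusV_momentSeries (κ μ : Series s A) :
    boxplusV (momentSeries κ) (momentSeries μ) = momentSeries (κ + μ) := by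
  funext w
  simp only [boxplusV_apply, freeProd_momentSeries, freeMoment_ofFn, ncSum, momentSeries]
  rw [Finset.sum_comm]
  exact Finset.sum_congr rfl fun P hP => sum_prod_mixedCumulant κ μ _ (mem_ncPartitions.1 hP)

theorem boxplusV_eq (f g : Series s A) :
    boxplusV f g = momentSeries (rTransform f + rTransform g) := by
  rw [← boxplusV_momentSeries, momentSeries_rTransform, momentSeries_rTransform]

end Convolution

/-! ## Naturality in the ring of coefficients -/

section Naturality

variable {s : ℕ} {A : Type u} [CommRing A] {B : Type v} [CommRing B]

theorem coeffs_map (φ : A →+* B) (κ : Series s A) (w : List (Fin s)) :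
    φ (coeffs κ w) = coeffs (fun u => φ (κ u)) w := by
  by_cases h : w = []
  · simp [coeffs, h]
  · rw [coeffs_of_ne_nil _ h, coeffs_of_ne_nil _ h]

theorem momentSeries_map (φ : A →+* B) (κ : Series s A) :
    (fun w => φ (momentSeries κ w)) = momentSeries fun w => φ (κ w) := by
  funext w
  simp only [momentSeries, ncSum, map_sum, map_prod, coeffs_map]

/-- Naturality is inherited from the inverse map `momentSeries`, so the Möbius series need not be
examined. It allows evaluation at dual numbers and at `t = 0`. -/
theorem rTransform_map (φ : A →+* B) (f : Series s A) :
    (fun w => φ (rTransform f w)) = rTransform fun w => φ (f w) := by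
  refine momentSeries_injective ?_
  rw [← momentSeries_map, momentSeries_rTransform, momentSeries_rTransform]

theorem boxplusV_map (φ : A →+* B) (f g : Series s A) :
    (fun w => φ (boxplusV f g w)) = boxplusV (fun w => φ (f w)) fun w => φ (g w) := by
  rw [boxplusV_eq, boxplusV_eq, momentSeries_map, ← rTransform_map, ← rTransform_map]
  simp only [Pi.add_apply, map_add]
  rfl

/-- Every partition other than the one-block one has two distinct blocks, hence two factors whose
product is zero. For `κ = εv` this says that the linear part is the identity. -/
theorem momentSeries_of_mul_eq_zero {κ : Series s A} (h : ∀ u w, κ u * κ w = 0) :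
    momentSeries κ = κ := by
  classical
  funext w
  rw [momentSeries_apply, sum_isNC_eq, blockProd_oneBlock, Finset.sum_eq_zero, add_zero]
  intro π hπ
  have hne := (Finset.mem_filter.1 hπ).2.2
  obtain ⟨V, hV, -⟩ := π.exists_mem (Finset.mem_univ ⟨0, List.length_pos_iff.2 w.2⟩)
  obtain ⟨a, ha⟩ : ∃ a, a ∉ V := by
    by_contra hcon
    push Not at hcon
    exact hne (Finset.eq_univ_of_forall hcon ▸ hV)
  obtain ⟨W, hW, haW⟩ := π.exists_mem (Finset.mem_univ a)
  have hWV : W ≠ V := fun h => ha (h ▸ haW)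
  rw [blockProd, ← Finset.mul_prod_erase _ _ hV,
    ← Finset.mul_prod_erase _ _ (Finset.mem_erase.2 ⟨hWV, hW⟩), ← mul_assoc,
    coeffs_of_ne_nil _ (restrict_ne_nil w.1 V (π.nonempty_of_mem_parts hV)),
    coeffs_of_ne_nil _ (restrict_ne_nil w.1 W (π.nonempty_of_mem_parts hW)), h, zero_mul]

theorem rTransform_of_mul_eq_zero {κ : Series s A} (h : ∀ u w, κ u * κ w = 0) :
    rTransform κ = κ := by
  conv_lhs => rw [← momentSeries_of_mul_eq_zero h]
  exact rTransform_momentSeries κ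

end Naturality

/-! ## Differentials via dual numbers -/

section DualNumbers

variable {s : ℕ} {A : Type u} [CommRing A]

/-- Evaluation of a polynomial at the point `ε v`. -/
noncomputable def evalEps (v : Series s A) : MvPolynomial (Word s) A →+* DualNumber A :=
  MvPolynomial.eval₂Hom (TrivSqZeroExt.inlHom A A) fun u => TrivSqZeroExt.inr (v u)

theorem evalEps_C (v : Series s A) (a : A) :
    evalEps v (MvPolynomial.C a) = TrivSqZeroExt.inl a := by
  simp [evalEps]

theorem evalEps_X (v : Series s A) (u : Word s) :
    evalEps v (MvPolynomial.X u) = TrivSqZeroExt.inr (v u) := by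
  simp [evalEps]

theorem fst_evalEps (v : Series s A) (p : MvPolynomial (Word s) A) :
    (evalEps v p).fst = MvPolynomial.constantCoeff p := by
  induction p using MvPolynomial.induction_on with
  | C a => simp [evalEps_C]
  | add p q hp hq => simp [hp, hq]
  | mul_X p n hp => simp [evalEps_X]

theorem snd_evalEps (v : Series s A) (T : Finset (Word s)) (hT : ∀ u, u ∉ T → v u = 0)
    (p : MvPolynomial (Word s) A) :
    (evalEps v p).snd =
      ∑ u ∈ T, MvPolynomial.constantCoeff (MvPolynomial.pderiv u p) * v u := by
  classical
  induction p using MvPolynomial.induction_on with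
  | C a => simp [evalEps_C]
  | add p q hp hq => simp [hp, hq, add_mul, Finset.sum_add_distrib]
  | mul_X p n hp =>
    have h : ∀ u, MvPolynomial.constantCoeff (MvPolynomial.pderiv u (p * MvPolynomial.X n)) * v u =
        if n = u then MvPolynomial.constantCoeff p * v n else 0 := by
      intro u
      rw [MvPolynomial.pderiv_mul, map_add, map_mul, map_mul, MvPolynomial.constantCoeff_X,
        mul_zero, zero_add, MvPolynomial.pderiv_X]
      by_cases hu : n = u
      · subst hu
        simp
      · simp [hu]
    rw [Finset.sum_congr rfl fun u _ => h u, Finset.sum_ite_eq]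
    by_cases hn : n ∈ T
    · simp [evalEps_X, fst_evalEps, hn, mul_comm]
    · simp [evalEps_X, hn, hT n hn]

theorem differentialAtZero_apply (P : Word s → MvPolynomial (Word s) A) (v : Series s A)
    (w : Word s) : differentialAtZero P v w = (evalEps v (P w)).snd := by
  classical
  -- The series `v` may have infinite support; cutting it down to the variables of `P w` makes the
  -- first-order expansion a finite sum.
  have h : evalEps v (P w) = evalEps (fun u => if u ∈ (P w).vars then v u else 0) (P w) := by
    refine MvPolynomial.eval₂Hom_congr' rfl (fun u hu _ => ?_) rfl
    simp only [if_pos hu]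
  rw [h, snd_evalEps _ (P w).vars fun u hu => if_neg hu]
  refine Finset.sum_congr rfl fun u hu => ?_
  rw [if_pos hu]
  rfl

theorem jacobianAtZero_apply [DecidableEq (Word s)] (P : Word s → MvPolynomial (Word s) A)
    (w u : Word s) : jacobianAtZero P w u = (evalEps (Pi.single u 1) (P w)).snd := by
  rw [snd_evalEps _ {u} fun u' hu' => Pi.single_eq_of_ne (by simpa using hu') _]
  simp [jacobianAtZero]

theorem inr_mul_inr_series (v : Series s A) (u w : Word s) :
    (TrivSqZeroExt.inr (v u) : DualNumber A) * TrivSqZeroExt.inr (v w) = 0 :=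
  TrivSqZeroExt.inr_mul_inr A _ _

theorem evalEps_rTransformPoly (v : Series s A) (w : Word s) :
    evalEps v (rTransformPoly s A w) = TrivSqZeroExt.inr (v w) := by
  have h := congrFun (rTransform_map (evalEps v) (MvPolynomial.X : Word s → _)) w
  simp only [evalEps_X] at h
  rw [rTransform_of_mul_eq_zero (inr_mul_inr_series v)] at h
  exact h

theorem jacobianAtZero_rTransformPoly [DecidableEq (Word s)] (w u : Word s) :
    jacobianAtZero (rTransformPoly s A) w u = (Pi.single u 1 : Series s A) w := by
  rw [jacobianAtZero_apply, evalEps_rTransformPoly, TrivSqZeroExt.snd_inr]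

theorem differentialAtZero_rTransformPoly (v : Series s A) :
    differentialAtZero (rTransformPoly s A) v = v := by
  funext w
  rw [differentialAtZero_apply, evalEps_rTransformPoly, TrivSqZeroExt.snd_inr]

theorem isLowerUnitriangular_rTransformPoly (r : List (Fin s) → List (Fin s) → Prop)
    (hr : ∀ w, ¬ r w w) : IsLowerUnitriangular r (jacobianAtZero (rTransformPoly s A)) := by
  classical
  constructor
  · intro w
    rw [jacobianAtZero_rTransformPoly, Pi.single_eq_same]
  · intro w u hwu
    rw [jacobianAtZero_rTransformPoly]
    refine Pi.single_eq_of_ne ?_ _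
    rintro rfl
    exact hr _ hwu

/-- To first order, left translation only shifts the free cumulants of `x` by `εv`. -/
theorem evalEps_leftTranslation (x v : Series s A) :
    (fun w => evalEps v (leftTranslation x w)) =
      momentSeries fun w => TrivSqZeroExt.inl (rTransform x w) + TrivSqZeroExt.inr (v w) := by
  rw [leftTranslation, boxplusV_map]
  simp only [evalEps_C, evalEps_X]
  rw [boxplusV_eq, rTransform_of_mul_eq_zero (inr_mul_inr_series v)]
  have h := rTransform_map (TrivSqZeroExt.inlHom A A) x
  simp only [TrivSqZeroExt.inlHom_apply] at h
  rw [← h]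
  rfl

end DualNumbers

/-! ## One-parameter subgroups -/

section Curves

open Polynomial

variable {s : ℕ}

/-- The ring homomorphism `p ↦ p + ε p'`. -/
noncomputable def derivEps (A : Type u) [CommRing A] : A[X] →+* DualNumber A[X] where
  toFun p := TrivSqZeroExt.inl p + TrivSqZeroExt.inr (derivative p)
  map_one' := by ext <;> simp
  map_zero' := by ext <;> simp
  map_add' p q := by ext <;> simp
  map_mul' p q := by
    refine TrivSqZeroExt.ext ?_ ?_
    · simp
    · simp only [TrivSqZeroExt.snd_add, TrivSqZeroExt.snd_inl, TrivSqZeroExt.snd_inr, zero_add,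
        TrivSqZeroExt.snd_mul, TrivSqZeroExt.fst_add, TrivSqZeroExt.fst_inl,
        TrivSqZeroExt.fst_inr, add_zero, derivative_mul, smul_eq_mul, MulOpposite.smul_eq_mul_unop,
        MulOpposite.unop_op]
      ring

theorem derivEps_apply {A : Type u} [CommRing A] (p : A[X]) :
    derivEps A p = TrivSqZeroExt.inl p + TrivSqZeroExt.inr (derivative p) := rfl

theorem inl_add_inr_inj {A : Type u} [CommRing A] {a b b' : A} :
    (TrivSqZeroExt.inl a + TrivSqZeroExt.inr b : DualNumber A) =
      TrivSqZeroExt.inl a + TrivSqZeroExt.inr b' ↔ b = b' := by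
  rw [add_right_inj]
  exact TrivSqZeroExt.inr_injective.eq_iff

variable {k : Type u} [Field k]

/-- Both sides are the `ε`-parts of dual-number series with constant part `γ`, namely `γ + εγ'` and
`γ ⊞ εv`. Their cumulants are `R(γ) + εR(γ)'` and `R(γ) + εv`, and `momentSeries` is injective. -/
theorem derivative_eq_differential_iff (v : Series s k) (γ : Word s → k[X]) :
    (∀ w, derivative (γ w) = differentialAtZero (leftTranslation γ) (fun u => C (v u)) w) ↔
      ∀ w, derivative (rTransform γ w) = C (v w) := by
  have hfst : ∀ w, (evalEps (fun u => C (v u)) (leftTranslation γ w)).fst = γ w := by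
    intro w
    have h := congrFun (momentSeries_map (TrivSqZeroExt.fstHom k[X] k[X] k[X]).toRingHom
      fun w => TrivSqZeroExt.inl (rTransform γ w) + TrivSqZeroExt.inr (C (v w))) w
    rw [← evalEps_leftTranslation] at h
    simpa [momentSeries_rTransform] using h
  have h1 : (∀ w, derivative (γ w) =
      differentialAtZero (leftTranslation γ) (fun u => C (v u)) w) ↔
      (fun w => derivEps k (γ w)) =
        fun w => evalEps (fun u => C (v u)) (leftTranslation γ w) := by
    rw [funext_iff]
    refine forall_congr' fun w => ?_
    rw [differentialAtZero_apply, TrivSqZeroExt.ext_iff, hfst, derivEps_apply]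
    simp
  rw [h1, evalEps_leftTranslation]
  conv_lhs => rw [← momentSeries_rTransform γ]
  rw [momentSeries_map, rTransform_momentSeries, momentSeries_injective.eq_iff, funext_iff]
  exact forall_congr' fun w => inl_add_inr_inj

theorem eval_zero_iff (γ : Word s → k[X]) :
    (∀ w, (γ w).eval 0 = 0) ↔ ∀ w, (rTransform γ w).eval 0 = 0 := by
  have h0 : rTransform (0 : Series s k) = 0 := rTransform_of_mul_eq_zero (by simp)
  have h := rTransform_map (evalRingHom (0 : k)) γ
  simp only [coe_evalRingHom] at h
  have h2 : (∀ w, (rTransform γ w).eval 0 = 0) ↔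
      rTransform (fun w => (γ w).eval 0) = rTransform 0 := by
    rw [← h, h0, funext_iff]
    rfl
  rw [h2, rTransform_injective.eq_iff, funext_iff]
  rfl

theorem isExpCurve_iff [CharZero k] (v : Series s k) (γ : Word s → k[X]) :
    IsExpCurve v γ ↔ γ = momentSeries fun w => C (v w) * X := by
  rw [IsExpCurve, derivative_eq_differential_iff, eval_zero_iff, ← forall_and]
  have h : γ = (momentSeries fun w => C (v w) * X) ↔ rTransform γ = fun w => C (v w) * X := by
    rw [← rTransform_injective.eq_iff, rTransform_momentSeries]
  rw [h, funext_iff]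
  refine forall_congr' fun w => ⟨fun ⟨h0, h1⟩ => ?_, fun h => by simp [h]⟩
  have hd : derivative (rTransform γ w - C (v w) * X) = 0 := by simp [h1]
  -- Characteristic `0` enters here: a polynomial with zero derivative is constant.
  have hc := eq_C_of_derivative_eq_zero hd
  have hz : (rTransform γ w - C (v w) * X).coeff 0 = 0 := by
    rw [coeff_zero_eq_eval_zero, eval_sub, h0]
    simp
  rw [hz, C_0] at hc
  exact sub_eq_zero.1 hc

theorem EXP_eq_momentSeries [CharZero k] : (EXP : Series s k → Series s k) = momentSeries := by
  funext v w
  -- Existence makes the chosen curve a genuine solution; uniqueness then identifies it with the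
  -- explicit one.
  have h : IsExpCurve v (Classical.epsilon (IsExpCurve v)) :=
    Classical.epsilon_spec ⟨_, (isExpCurve_iff v _).2 rfl⟩
  have h1 := congrFun (momentSeries_map (evalRingHom (1 : k)) fun w => C (v w) * X) w
  rw [EXP, (isExpCurve_iff v _).1 h]
  simpa using h1

theorem LOG_eq_rTransform [CharZero k] : (LOG : Series s k → Series s k) = rTransform := by
  funext f
  rw [LOG, EXP_eq_momentSeries]
  conv_lhs => rw [← momentSeries_rTransform f]
  exact Function.leftInverse_invFun momentSeries_injective _

end Curves

end FreeCumulants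

theorem mainTheorem10 (s : ℕ) (k : Type*) [Field k] [CharZero k] :
    -- the Moebius series is the two-sided inverse of the zeta series
    (FreeCumulants.boxed FreeCumulants.zeta FreeCumulants.moeb =
        (FreeCumulants.boxedUnit : FreeCumulants.Series s k) ∧
      FreeCumulants.boxed FreeCumulants.moeb FreeCumulants.zeta =
        (FreeCumulants.boxedUnit : FreeCumulants.Series s k)) ∧
    -- the exponential map is well defined and bijective, so that `LOG` is its inverse
    (∀ v : FreeCumulants.Series s k, ∃! γ, FreeCumulants.IsExpCurve v γ) ∧
    Function.Bijective (FreeCumulants.EXP : FreeCumulants.Series s k → FreeCumulants.Series s k) ∧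
    -- the matrix of `dR` is lower triangular with unit diagonal, both for the
    -- length-lexicographic and for the lexicographic ordering of words
    FreeCumulants.IsLowerUnitriangular (List.Shortlex (· < ·))
      (FreeCumulants.jacobianAtZero (FreeCumulants.rTransformPoly s k)) ∧
    FreeCumulants.IsLowerUnitriangular (List.Lex (· < ·))
      (FreeCumulants.jacobianAtZero (FreeCumulants.rTransformPoly s k)) ∧
    -- the R-transform is `dR ∘ LOG`
    ∀ f : FreeCumulants.Series s k,
      FreeCumulants.rTransform f = FreeCumulants.dR s k (FreeCumulants.LOG f) := by
  have hlex : ∀ w : List (Fin s), ¬ List.Lex (· < ·) w w := List.lex_irrefl fun _ => lt_irrefl _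
  refine ⟨⟨FreeCumulants.boxed_zeta_moeb, ?_⟩, fun v => ?_, ?_, ?_, ?_, fun f => ?_⟩
  · rw [FreeCumulants.boxed_zeta, FreeCumulants.momentSeries_moeb]
  · exact ⟨_, (FreeCumulants.isExpCurve_iff v _).2 rfl,
      fun γ hγ => (FreeCumulants.isExpCurve_iff v γ).1 hγ⟩
  · rw [FreeCumulants.EXP_eq_momentSeries]
    exact ⟨FreeCumulants.momentSeries_injective,
      fun f => ⟨_, FreeCumulants.momentSeries_rTransform f⟩⟩
  · refine FreeCumulants.isLowerUnitriangular_rTransformPoly _ fun w h => ?_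
    rcases List.shortlex_def.1 h with h | h
    · exact lt_irrefl _ h
    · exact hlex w h.2
  · exact FreeCumulants.isLowerUnitriangular_rTransformPoly _ hlex
  · rw [FreeCumulants.LOG_eq_rTransform, FreeCumulants.dR,
      FreeCumulants.differentialAtZero_rTransformPoly]
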